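/- Let $M$ be a smooth $n$-dimensional manifold with a smooth metric $g_{ij}$ (Riemannian or, more generally, of any signature), let $V$ be a smooth real function on $M$, and let $Y=Y^i\partial_i$ be a smooth vector field on $M$ that is a Killing vector (KV, $L_Yg_{ij}=0$) or a homothetic vector (HV, $L_Yg_{ij}=2\psi g_{ij}$ with $\psi$ a real constant) of $g_{ij}$. Consider the Schrödinger equation in the form $$\Delta u-u_{,t}=V(x^k)\,u,\qquad \Delta u=g^{ij}u_{,ij}-g^{jk}\Gamma^i_{jk}u_{,i},\qquad t\in\mathbb R,\ x\in M,$$ for a real function $u(t,x)$, and the classical Lagrangian $L=\tfrac12 g_{ij}\dot x^i\dot x^j-V(x^k)$. Say that $Y$ *produces a Lie point symmetry* of the Schrödinger equation if there are smooth functions $T(t)$, not identically zero, $\xi(t,x,u)$ and $\eta(t,x,u)$ such that $X=\xi\,\partial_t+T(t)Y^i\partial_i+\eta\,\partial_u$ is a Lie point symmetry of the equation, that is, with $H=\Delta u-u_{,t}-Vu$ regarded as a function on the second order jet space and $X^{[2]}$ the second prolongation of $X$, there is a function $\lambda$ on the jet space with $X^{[2]}H=\lambda H$. Say that $Y$ *generates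 a Noether point symmetry* of $L$ if there are smooth functions $T(t)$, not identically zero, $\tau(t,x)$ and $f(t,x)$ such that $\mathbf X=\tau\,\partial_t+T(t)Y^i\partial_i$ satisfies $\mathbf X^{[1]}L+\frac{d\tau}{dt}L=\frac{df}{dt}$ identically in $(t,x,\dot x)$, where $\mathbf X^{[1]}$ is the first prolongation of $\mathbf X$. (The functions $T$ in the two definitions need not be the same.) Then $Y$ produces a Lie point symmetry of the Schrödinger equation if and only if it generates a Noether point symmetry of the Lagrangian $L$. -/

import Mathlib

open scoped Manifold ContDiff

noncomputable section

namespace PointSym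

/-! ### Point transformations of second order scalar PDEs

`ι` indexes the independent variables `z = (zⁱ)`, `u` is the dependent variable,
`p i` stands for `u_{,i}` and `q i j` for `u_{,ij}`. -/

/-- First order jets `(z, u, p)`. -/
abbrev Jet1 (ι : Type) : Type := (ι → ℝ) × ℝ × (ι → ℝ)

/-- Second order jets `(z, u, p, q)`; only those with `q` symmetric are jets of functions. -/
abbrev Jet2 (ι : Type) : Type := (ι → ℝ) × ℝ × (ι → ℝ) × (ι → ι → ℝ)

section PDE

variable {ι : Type} [Fintype ι] [DecidableEq ι]

/-- The total derivative `D_i F = F_{,i} + u_{,i} F_{,u}` of a function `F (z, u)`. -/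
def totalDeriv0 (F : (ι → ℝ) × ℝ → ℝ) (i : ι) (J : Jet1 ι) : ℝ :=
  fderiv ℝ F (J.1, J.2.1) (Pi.single i 1, J.2.2 i)

/-- The total derivative `D_i F = F_{,i} + u_{,i} F_{,u} + ∑ k, u_{,ki} ∂F/∂u_{,k}` of a
function `F (z, u, p)`. -/
def totalDeriv1 (F : Jet1 ι → ℝ) (i : ι) (J : Jet2 ι) : ℝ :=
  fderiv ℝ F (J.1, J.2.1, J.2.2.1) (Pi.single i 1, J.2.2.1 i, fun k => J.2.2.2 k i)

/-- `η_[i] = D_i η - u_{,j} D_i ξʲ`. -/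
def prolongCoeff1 (ξ : ι → (ι → ℝ) × ℝ → ℝ) (η : (ι → ℝ) × ℝ → ℝ) (i : ι) (J : Jet1 ι) : ℝ :=
  totalDeriv0 η i J - ∑ j, J.2.2 j * totalDeriv0 (ξ j) i J

/-- `η_[ij] = D_j η_[i] - u_{,ik} D_j ξᵏ`. -/
def prolongCoeff2 (ξ : ι → (ι → ℝ) × ℝ → ℝ) (η : (ι → ℝ) × ℝ → ℝ) (i j : ι) (J : Jet2 ι) : ℝ :=
  totalDeriv1 (prolongCoeff1 ξ η i) j J
    - ∑ k, J.2.2.2 i k * totalDeriv0 (ξ k) j (J.1, J.2.1, J.2.2.1)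

/-- `X^[2] H`: the derivative of `H` along the second prolongation of
`X = ξⁱ ∂_i + η ∂_u`. -/
def prolong2 (ξ : ι → (ι → ℝ) × ℝ → ℝ) (η : (ι → ℝ) × ℝ → ℝ) (H : Jet2 ι → ℝ)
    (J : Jet2 ι) : ℝ :=
  fderiv ℝ H J
    (fun i => ξ i (J.1, J.2.1), η (J.1, J.2.1),
      fun i => prolongCoeff1 ξ η i (J.1, J.2.1, J.2.2.1), fun i j => prolongCoeff2 ξ η i j J)

/-- `X = ξⁱ(z,u) ∂_i + η(z,u) ∂_u` is smooth over `U` and is a Lie point symmetry over `U` of the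
second order equation `H = 0`: there is a function `μ` on the jet space with `X^[2] H = μ H`. -/
def IsLiePointSymmetryOn (H : Jet2 ι → ℝ) (U : Set (ι → ℝ))
    (ξ : ι → (ι → ℝ) × ℝ → ℝ) (η : (ι → ℝ) × ℝ → ℝ) : Prop :=
  (∀ i, ContDiffOn ℝ ∞ (ξ i) (U ×ˢ Set.univ)) ∧ ContDiffOn ℝ ∞ η (U ×ˢ Set.univ) ∧
    ∃ μ : Jet2 ι → ℝ, ∀ J : Jet2 ι, J.1 ∈ U → (∀ i j, J.2.2.2 i j = J.2.2.2 j i) →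
      prolong2 ξ η H J = μ J * H J

end PDE

/-! ### Noether point symmetries -/

section Noether

variable {n : ℕ}

/-- `dF/dt = F_{,t} + ẋᵏ F_{,k}` for `F (t, x)`, as a function of `(t, x, ẋ)`. -/
def timeDeriv (F : ℝ × (Fin n → ℝ) → ℝ) (t : ℝ) (x v : Fin n → ℝ) : ℝ :=
  fderiv ℝ F (t, x) (1, v)

/-- `X^[1] L` for `X = τ ∂_t + ηⁱ ∂_i` and a Lagrangian `L (t, x, ẋ)`; the coefficient of
`∂/∂ẋⁱ` is `dηⁱ/dt - ẋⁱ dτ/dt`. -/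
def prolongLagrangian (τ : ℝ × (Fin n → ℝ) → ℝ) (η : Fin n → ℝ × (Fin n → ℝ) → ℝ)
    (L : ℝ × (Fin n → ℝ) × (Fin n → ℝ) → ℝ) (t : ℝ) (x v : Fin n → ℝ) : ℝ :=
  fderiv ℝ L (t, x, v)
    (τ (t, x), fun i => η i (t, x), fun i => timeDeriv (η i) t x v - v i * timeDeriv τ t x v)

/-- `X = τ(t,x) ∂_t + ηⁱ(t,x) ∂_i` is smooth over `ℝ × U` and is there a Noether point symmetry of
`L` with gauge function `f`: `X^[1] L + (dτ/dt) L = df/dt`. -/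
def IsNoetherPointSymmetryOn (L : ℝ × (Fin n → ℝ) × (Fin n → ℝ) → ℝ) (U : Set (Fin n → ℝ))
    (τ : ℝ × (Fin n → ℝ) → ℝ) (η : Fin n → ℝ × (Fin n → ℝ) → ℝ)
    (f : ℝ × (Fin n → ℝ) → ℝ) : Prop :=
  ContDiffOn ℝ ∞ τ (Set.univ ×ˢ U) ∧ (∀ i, ContDiffOn ℝ ∞ (η i) (Set.univ ×ˢ U)) ∧
    ContDiffOn ℝ ∞ f (Set.univ ×ˢ U) ∧
    ∀ (t : ℝ) (x v : Fin n → ℝ), x ∈ U →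
      prolongLagrangian τ η L t x v + timeDeriv τ t x v * L (t, x, v) = timeDeriv f t x v

end Noether

/-! ### Metrics in coordinates -/

section Coordinates

variable {n : ℕ}

/-- The partial derivative `F_{,i}`. -/
def pd (F : (Fin n → ℝ) → ℝ) (i : Fin n) (x : Fin n → ℝ) : ℝ :=
  fderiv ℝ F x (Pi.single i 1)

/-- The Christoffel symbols `Γⁱ_{jk}` of the metric `g`. -/
def christoffel (g : (Fin n → ℝ) → Matrix (Fin n) (Fin n) ℝ) (i j k : Fin n)
    (x : Fin n → ℝ) : ℝ :=
  (1 / 2) * ∑ l, (g x)⁻¹ i l *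
    (pd (fun y => g y l j) k x + pd (fun y => g y l k) j x - pd (fun y => g y j k) l x)

/-- `Γⁱ = g^{jk} Γⁱ_{jk}`. -/
def christoffelTrace (g : (Fin n → ℝ) → Matrix (Fin n) (Fin n) ℝ) (i : Fin n)
    (x : Fin n → ℝ) : ℝ :=
  ∑ j, ∑ k, (g x)⁻¹ j k * christoffel g i j k x

/-- The components `(L_Y g)_{ij} = Yᵏ g_{ij,k} + g_{kj} Yᵏ_{,i} + g_{ik} Yᵏ_{,j}`. -/
def lieDerivMetric (g : (Fin n → ℝ) → Matrix (Fin n) (Fin n) ℝ)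
    (Y : Fin n → (Fin n → ℝ) → ℝ) (i j : Fin n) (x : Fin n → ℝ) : ℝ :=
  ∑ k, (Y k x * pd (fun y => g y i j) k x + g x k j * pd (Y k) i x + g x i k * pd (Y k) j x)

/-- The function `g^{ij} u_{,ij} - Γⁱ u_{,i} - u_{,t} - V u` on the second order jets in the
independent variables `(t, x)`, so that its zero set is the Schrödinger equation
`Δ u - u_{,t} = V u`. The index `none` stands for `t` and `some i` for `xⁱ`. -/
def schrodinger (g : (Fin n → ℝ) → Matrix (Fin n) (Fin n) ℝ) (V : (Fin n → ℝ) → ℝ)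
    (J : Jet2 (Option (Fin n))) : ℝ :=
  (∑ i, ∑ j, (g fun k => J.1 (some k))⁻¹ i j * J.2.2.2 (some i) (some j))
    - (∑ i, christoffelTrace g i (fun k => J.1 (some k)) * J.2.2.1 (some i))
    - J.2.2.1 none - V (fun k => J.1 (some k)) * J.2.1

/-- The Lagrangian `L = ½ g_{ij} ẋⁱ ẋʲ - V`. -/
def lagrangian (g : (Fin n → ℝ) → Matrix (Fin n) (Fin n) ℝ) (V : (Fin n → ℝ) → ℝ)
    (w : ℝ × (Fin n → ℝ) × (Fin n → ℝ)) : ℝ :=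
  (1 / 2) * (∑ i, ∑ j, g w.2.1 i j * w.2.2 i * w.2.2 j) - V w.2.1

end Coordinates

/-! ### Smooth manifolds -/

section Manifold

variable {n : ℕ} {M : Type*} [TopologicalSpace M] [ChartedSpace (EuclideanSpace ℝ (Fin n)) M]

/-- The range of the coordinates of a chart `e`, as a subset of `Fin n → ℝ`. -/
def coordRange (e : OpenPartialHomeomorph M (EuclideanSpace ℝ (Fin n))) : Set (Fin n → ℝ) :=
  {x | WithLp.toLp 2 x ∈ e.target}

/-- The point of `M` with coordinates `x` in the chart `e`. -/
def coordPoint (e : OpenPartialHomeomorph M (EuclideanSpace ℝ (Fin n))) (x : Fin n → ℝ) : M :=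
  e.symm (WithLp.toLp 2 x)

/-- The `i`-th component of the tangent vector `v` at `coordPoint e x` in the chart `e`. -/
def coordComp (e : OpenPartialHomeomorph M (EuclideanSpace ℝ (Fin n))) (x : Fin n → ℝ)
    (v : TangentSpace (𝓡 n) (coordPoint e x)) (i : Fin n) : ℝ :=
  (show EuclideanSpace ℝ (Fin n) from mfderiv (𝓡 n) (𝓡 n) e (coordPoint e x) v) i

/-- The coordinate vector `∂_i` of the chart `e` at the point with coordinates `x`. -/
def coordVec (e : OpenPartialHomeomorph M (EuclideanSpace ℝ (Fin n))) (x : Fin n → ℝ)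
    (i : Fin n) : TangentSpace (𝓡 n) (coordPoint e x) :=
  mfderiv (𝓡 n) (𝓡 n) e.symm (WithLp.toLp 2 x)
    (show TangentSpace (𝓡 n) (WithLp.toLp 2 x : EuclideanSpace ℝ (Fin n)) from
      EuclideanSpace.single i (1 : ℝ))

variable (n M) in
/-- A smooth metric of arbitrary signature (in particular, a Riemannian metric) on `M`. -/
structure Metric where
  /-- the bilinear form on each tangent space -/
  val : ∀ x : M, TangentSpace (𝓡 n) x →ₗ[ℝ] TangentSpace (𝓡 n) x →ₗ[ℝ] ℝ
  symm : ∀ (x : M) (v w : TangentSpace (𝓡 n) x), val x v w = val x w v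
  nondegenerate : ∀ (x : M) (v : TangentSpace (𝓡 n) x), (∀ w, val x v w = 0) → v = 0
  smooth : ∀ e ∈ IsManifold.maximalAtlas (𝓡 n) ∞ M, ∀ i j : Fin n,
    ContDiffOn ℝ ∞
      (fun x : Fin n → ℝ => val (coordPoint e x) (coordVec e x i) (coordVec e x j)) (coordRange e)

/-- The components `g_{ij}` of the metric in the chart `e`. -/
def Metric.comp (g : Metric n M) (e : OpenPartialHomeomorph M (EuclideanSpace ℝ (Fin n)))
    (x : Fin n → ℝ) : Matrix (Fin n) (Fin n) ℝ :=
  Matrix.of fun i j => g.val (coordPoint e x) (coordVec e x i) (coordVec e x j)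

/-- `Y` is a homothetic vector field of `g` with constant factor `ψ`, that is `L_Y g = 2 ψ g`. -/
def HasHomotheticFactor (g : Metric n M) (Y : ∀ x : M, TangentSpace (𝓡 n) x) (ψ : ℝ) : Prop :=
  ∀ e ∈ IsManifold.maximalAtlas (𝓡 n) ∞ M, ∀ x ∈ coordRange e, ∀ i j : Fin n,
    lieDerivMetric (g.comp e) (fun k y => coordComp e y (Y (coordPoint e y)) k) i j x
      = 2 * ψ * g.comp e x i j

/-- `Y` is a Killing vector field (KV) of `g`. -/
def IsKilling (g : Metric n M) (Y : ∀ x : M, TangentSpace (𝓡 n) x) : Prop :=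
  HasHomotheticFactor g Y 0

/-- `Y` is a homothetic vector field (HV) of `g`. -/
def IsHomothetic (g : Metric n M) (Y : ∀ x : M, TangentSpace (𝓡 n) x) : Prop :=
  ∃ ψ : ℝ, HasHomotheticFactor g Y ψ

/-- The vector field `X = ξ ∂_t + Ξ + η ∂_u` on `ℝ × M × ℝ ∋ (t, x, u)`, with `Ξ` tangent to `M`,
is smooth and is a Lie point symmetry of the Schrödinger equation `Δ u - u_{,t} = V u` on
`ℝ × M`: this holds in the coordinates of each chart of `M`. -/
def IsLiePointSymmetry (g : Metric n M) (V : M → ℝ) (ξ : ℝ × M × ℝ → ℝ)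
    (Ξ : ∀ w : ℝ × M × ℝ, TangentSpace (𝓡 n) w.2.1) (η : ℝ × M × ℝ → ℝ) : Prop :=
  ∀ e ∈ IsManifold.maximalAtlas (𝓡 n) ∞ M,
    IsLiePointSymmetryOn (ι := Option (Fin n))
      (schrodinger (g.comp e) fun x => V (coordPoint e x))
      {z | (fun i => z (some i)) ∈ coordRange e}
      (fun a w => a.elim
        (ξ (w.1 none, coordPoint e (fun i => w.1 (some i)), w.2))
        (coordComp e (fun i => w.1 (some i))
          (Ξ (w.1 none, coordPoint e (fun i => w.1 (some i)), w.2))))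
      (fun w => η (w.1 none, coordPoint e (fun i => w.1 (some i)), w.2))

/-- The vector field `X = τ ∂_t + Ξ` on `ℝ × M ∋ (t, x)`, with `Ξ` tangent to `M`, is smooth and is
a Noether point symmetry of the Lagrangian `½ g_{ij} ẋⁱ ẋʲ - V` on `M`, with some smooth gauge
function `f (t, x)`: the Noether condition holds in the coordinates of each chart of `M`. -/
def IsNoetherPointSymmetry (g : Metric n M) (V : M → ℝ) (τ : ℝ × M → ℝ)
    (Ξ : ∀ w : ℝ × M, TangentSpace (𝓡 n) w.2) : Prop :=
  ∃ f : ℝ × M → ℝ, ∀ e ∈ IsManifold.maximalAtlas (𝓡 n) ∞ M,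
    IsNoetherPointSymmetryOn
      (lagrangian (g.comp e) fun x => V (coordPoint e x)) (coordRange e)
      (fun w => τ (w.1, coordPoint e w.2))
      (fun i w => coordComp e w.2 (Ξ (w.1, coordPoint e w.2)) i)
      (fun w => f (w.1, coordPoint e w.2))

/-- The vector field `Y` of `M` produces a Lie point symmetry of the Schrödinger equation: some Lie
point symmetry has the form `ξ ∂_t + T(t) Yⁱ ∂_i + η ∂_u` with `T` not identically zero. -/
def ProducesLiePointSymmetry (g : Metric n M) (V : M → ℝ)
    (Y : ∀ x : M, TangentSpace (𝓡 n) x) : Prop :=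
  ∃ T : ℝ → ℝ, ContDiff ℝ ∞ T ∧ (∃ t, T t ≠ 0) ∧
    ∃ ξ η : ℝ × M × ℝ → ℝ, IsLiePointSymmetry g V ξ (fun w => T w.1 • Y w.2.1) η

/-- The vector field `Y` of `M` generates a Noether point symmetry of the Lagrangian
`½ g_{ij} ẋⁱ ẋʲ - V`: some Noether point symmetry has the form `τ ∂_t + T(t) Yⁱ ∂_i` with `T` not
identically zero. -/
def GeneratesNoetherPointSymmetry (g : Metric n M) (V : M → ℝ)
    (Y : ∀ x : M, TangentSpace (𝓡 n) x) : Prop :=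
  ∃ T : ℝ → ℝ, ContDiff ℝ ∞ T ∧ (∃ t, T t ≠ 0) ∧
    ∃ τ : ℝ × M → ℝ, IsNoetherPointSymmetry g V τ (fun w => T w.1 • Y w.2)

end Manifold

end PointSym

end

noncomputable section

namespace PointSym

/-! ### Calculus on open sets -/

section Calculus

variable {E : Type*} [NormedAddCommGroup E] [NormedSpace ℝ E]

/-! Write `W = Y(V) + 2ψV` and `Y_i = g_{ij} Yʲ`. Both symmetry properties are equivalent to one
condition on `M` alone: there is a constant `c` with `∂_i W = c Y_i` everywhere
(`HasVariationFactor`).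

Necessity, Schrödinger side. On jets that satisfy the equation the unknown multiplier disappears,
and the remaining jet variables are free. Comparing coefficients shows that `ξ` depends neither on
`x` nor on `u`, that `ξ_t = 2ψT`, and that `η` is affine in `u`. Its `u`-coefficient `A` satisfies
`A_i = -½ T' Y_i` and `A_t = ΔA - T W`. A homothetic vector has constant divergence `nψ`, so `A_t =
-½ nψ T' - T W`. Equality of the mixed derivatives of `A` then gives `2T ∂_i W = T'' Y_i`
(`lie_compatibility`).

Necessity, Noether side. The Noether condition is a cubic polynomial in the velocities. Its
coefficients give `τ_i = 0`, `τ_t = 2ψT`, `f_i = T' Y_i` and `f_t = -T W`; the mixed derivatives of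
`f` give `T ∂_i W = -T'' Y_i` (`noether_compatibility`). On either side, evaluation at a single time
with `T ≠ 0` produces the constant `c`.

Sufficiency. Given `c`, it is enough to solve `T'' = 2cT` for the Lie symmetry and `T'' = -cT` for
the Noether symmetry, together with an `α` such that `α' = -T` (`exists_oscillation`). Then `ξ = τ =
-2ψα`, `η = (αW - ½ nψ T) u` and `f = αW` work (`isLiePointSymmetryOn`, `isNoetherPointSymmetryOn`).
The time functions solve different equations, which is why the two definitions must not share `T`.

The geometric input is how a homothetic field acts on `g⁻¹` and on the contracted Christoffel
symbols (`matrixDeriv_inv`, `fderiv_christoffelTrace`). It makes all derivatives of `Y` cancel from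
the second prolongation (`prolong2_schrodinger`). -/

theorem fderiv_apply_contDiffOn {F : E → ℝ} {U : Set E} (hU : IsOpen U)
    (hF : ContDiffOn ℝ ∞ F U) (v : E) : ContDiffOn ℝ ∞ (fun w => fderiv ℝ F w v) U :=
  (hF.fderiv_of_isOpen hU (m := ∞) (by simp)).clm_apply contDiffOn_const

theorem differentiableAt_of_contDiffOn {F : E → ℝ} {U : Set E} (hU : IsOpen U)
    (hF : ContDiffOn ℝ ∞ F U) {w : E} (hw : w ∈ U) : DifferentiableAt ℝ F w :=
  (hF.contDiffAt (hU.mem_nhds hw)).differentiableAt (by simp)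

theorem differentiableAt_fderiv_of_contDiffOn {F : E → ℝ} {U : Set E} (hU : IsOpen U)
    (hF : ContDiffOn ℝ ∞ F U) {w : E} (hw : w ∈ U) : DifferentiableAt ℝ (fderiv ℝ F) w :=
  ((hF.fderiv_of_isOpen hU (m := ∞) (by simp)).contDiffAt (hU.mem_nhds hw)).differentiableAt
    (by simp)

theorem fderiv_fderiv_apply {F : E → ℝ} {U : Set E} (hU : IsOpen U)
    (hF : ContDiffOn ℝ ∞ F U) {w : E} (hw : w ∈ U) (v d : E) :
    fderiv ℝ (fun y => fderiv ℝ F y v) w d = fderiv ℝ (fderiv ℝ F) w d v := by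
  have h := (differentiableAt_fderiv_of_contDiffOn hU hF hw).hasFDerivAt.clm_apply
    (hasFDerivAt_const v w)
  rw [h.fderiv]
  simp

theorem fderiv_fderiv_symm {F : E → ℝ} {U : Set E} (hU : IsOpen U)
    (hF : ContDiffOn ℝ ∞ F U) {w : E} (hw : w ∈ U) (v d : E) :
    fderiv ℝ (fderiv ℝ F) w d v = fderiv ℝ (fderiv ℝ F) w v d :=
  ((hF.contDiffAt (hU.mem_nhds hw)).isSymmSndFDerivAt
    (by simpa using WithTop.coe_le_coe.2 (le_top : (2 : ℕ∞) ≤ ⊤))) d v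

theorem fderiv_congr_of_eqOn {F G : E → ℝ} {U : Set E} (hU : IsOpen U)
    (h : ∀ y ∈ U, F y = G y) {w : E} (hw : w ∈ U) : fderiv ℝ F w = fderiv ℝ G w :=
  Filter.EventuallyEq.fderiv_eq (Filter.eventuallyEq_of_mem (hU.mem_nhds hw) h)

/-- Equality of mixed partial derivatives, for prescribed first derivatives. -/
theorem fderiv_comm_of_eqOn {F P Q : E → ℝ} {U : Set E} (hU : IsOpen U)
    (hF : ContDiffOn ℝ ∞ F U) {v d : E} (hP : ∀ y ∈ U, fderiv ℝ F y v = P y)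
    (hQ : ∀ y ∈ U, fderiv ℝ F y d = Q y) {w : E} (hw : w ∈ U) :
    fderiv ℝ P w d = fderiv ℝ Q w v := by
  rw [← fderiv_congr_of_eqOn hU hP hw, ← fderiv_congr_of_eqOn hU hQ hw,
    fderiv_fderiv_apply hU hF hw, fderiv_fderiv_apply hU hF hw, fderiv_fderiv_symm hU hF hw]

theorem fderiv_mul_apply {F G : E → ℝ} {w : E} (hF : DifferentiableAt ℝ F w)
    (hG : DifferentiableAt ℝ G w) (v : E) :
    fderiv ℝ (fun y => F y * G y) w v = F w * fderiv ℝ G w v + G w * fderiv ℝ F w v := by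
  rw [fderiv_fun_mul hF hG]
  simp

theorem fderiv_sum_apply {κ : Type*} [Fintype κ] {F : κ → E → ℝ} {w : E}
    (hF : ∀ k, DifferentiableAt ℝ (F k) w) (v : E) :
    fderiv ℝ (fun y => ∑ k, F k y) w v = ∑ k, fderiv ℝ (F k) w v := by
  rw [fderiv_fun_sum fun k _ => hF k]
  simp

end Calculus

theorem fderiv_eq_sum_pd {n : ℕ} (F : (Fin n → ℝ) → ℝ) (x v : Fin n → ℝ) :
    fderiv ℝ F x v = ∑ k, v k * pd F k x := by
  conv_lhs => rw [pi_eq_sum_univ' v]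
  simp [pd, map_sum]

/-! ### Quadratic forms -/

/-- By polarization, a symmetric matrix whose quadratic form vanishes identically is zero, and then
its determinant is zero as soon as `n ≥ 1`; the index `i` only excludes `n = 0`. This replaces
positivity of the metric, which is not available in arbitrary signature. -/
theorem exists_quadratic_ne_zero {n : ℕ} (A : Matrix (Fin n) (Fin n) ℝ) (hA : A.IsSymm)
    (hdet : IsUnit A.det) (i : Fin n) : ∃ v : Fin n → ℝ, ∑ j, ∑ k, A j k * v j * v k ≠ 0 := by
  by_contra! h
  have hq : ∀ v : Fin n → ℝ, v ⬝ᵥ A.mulVec v = 0 := fun v => by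
    rw [← h v]
    simp only [dotProduct, Matrix.mulVec, Finset.mul_sum]
    exact Finset.sum_congr rfl fun j _ => Finset.sum_congr rfl fun k _ => by ring
  have hs : ∀ v w : Fin n → ℝ, w ⬝ᵥ A.mulVec v = v ⬝ᵥ A.mulVec w := fun v w => by
    rw [Matrix.dotProduct_mulVec, ← Matrix.mulVec_transpose, hA.eq, dotProduct_comm]
  have hb : ∀ v w : Fin n → ℝ, v ⬝ᵥ A.mulVec w = 0 := fun v w => by
    have h1 := hq (v + w)
    simp only [Matrix.mulVec_add, dotProduct_add, add_dotProduct, hq, hs v w] at h1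
    linarith
  have h0 : A = 0 := by
    ext j k
    have := hb (Pi.single j 1) (Pi.single k 1)
    simpa using this
  have hn : Nonempty (Fin n) := ⟨i⟩
  rw [h0, Matrix.det_zero] at hdet
  exact not_isUnit_zero hdet

/-! ### Homothetic vector fields in coordinates -/

section Coordinates

variable {n : ℕ}

/-- On the open set `U`, the functions `g i j` are the components of a smooth metric, the `Y i`
are those of a smooth vector field, and `L_Y g = 2 ψ g`. -/
structure IsHomotheticOn (g : (Fin n → ℝ) → Matrix (Fin n) (Fin n) ℝ)
    (Y : Fin n → (Fin n → ℝ) → ℝ) (ψ : ℝ) (U : Set (Fin n → ℝ)) : Prop where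
  isOpen : IsOpen U
  smooth_metric : ∀ i j, ContDiffOn ℝ ∞ (fun x => g x i j) U
  isSymm : ∀ x ∈ U, (g x).IsSymm
  isUnit_det : ∀ x ∈ U, IsUnit (g x).det
  smooth_field : ∀ i, ContDiffOn ℝ ∞ (Y i) U
  lieDeriv : ∀ x ∈ U, ∀ i j, lieDerivMetric g Y i j x = 2 * ψ * g x i j

/-- The components `Y_i = g_{ij} Yʲ`. -/
def lowered (g : (Fin n → ℝ) → Matrix (Fin n) (Fin n) ℝ) (Y : Fin n → (Fin n → ℝ) → ℝ)
    (i : Fin n) (x : Fin n → ℝ) : ℝ := ∑ j, g x i j * Y j x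

/-- The function `Y(V) + 2 ψ V`. -/
def potentialVariation (Y : Fin n → (Fin n → ℝ) → ℝ) (ψ : ℝ) (V : (Fin n → ℝ) → ℝ)
    (x : Fin n → ℝ) : ℝ := ∑ k, Y k x * pd V k x + 2 * ψ * V x

/-- `∂Yⁱ/∂xʲ` as a matrix. -/
def jacobian (Y : Fin n → (Fin n → ℝ) → ℝ) (x : Fin n → ℝ) : Matrix (Fin n) (Fin n) ℝ :=
  Matrix.of fun i j => pd (Y i) j x

/-- The Christoffel symbols `Γ_{l,jk}` of the first kind, as matrices in `j, k`. -/
def christoffelFirst (g : (Fin n → ℝ) → Matrix (Fin n) (Fin n) ℝ) (l : Fin n)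
    (x : Fin n → ℝ) : Matrix (Fin n) (Fin n) ℝ :=
  Matrix.of fun j k => (1 / 2) *
    (pd (fun y => g y l j) k x + pd (fun y => g y l k) j x - pd (fun y => g y j k) l x)

/-- The entrywise derivative of a matrix valued function in the direction `v`. -/
def matrixDeriv (A : (Fin n → ℝ) → Matrix (Fin n) (Fin n) ℝ) (v x : Fin n → ℝ) :
    Matrix (Fin n) (Fin n) ℝ :=
  Matrix.of fun i j => fderiv ℝ (fun y => A y i j) x v

theorem pd_contDiffOn {F : (Fin n → ℝ) → ℝ} {U : Set (Fin n → ℝ)} (hU : IsOpen U)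
    (hF : ContDiffOn ℝ ∞ F U) (i : Fin n) : ContDiffOn ℝ ∞ (pd F i) U :=
  fderiv_apply_contDiffOn hU hF _

theorem pd_comm {F : (Fin n → ℝ) → ℝ} {U : Set (Fin n → ℝ)} (hU : IsOpen U)
    (hF : ContDiffOn ℝ ∞ F U) {x : Fin n → ℝ} (hx : x ∈ U) (i j : Fin n) :
    pd (pd F i) j x = pd (pd F j) i x :=
  fderiv_comm_of_eqOn hU hF (fun _ _ => rfl) (fun _ _ => rfl) hx

theorem pd_mul {F G : (Fin n → ℝ) → ℝ} {x : Fin n → ℝ} (hF : DifferentiableAt ℝ F x)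
    (hG : DifferentiableAt ℝ G x) (i : Fin n) :
    pd (fun y => F y * G y) i x = F x * pd G i x + G x * pd F i x :=
  fderiv_mul_apply hF hG _

theorem pd_sum {κ : Type*} [Fintype κ] {F : κ → (Fin n → ℝ) → ℝ} {x : Fin n → ℝ}
    (hF : ∀ k, DifferentiableAt ℝ (F k) x) (i : Fin n) :
    pd (fun y => ∑ k, F k y) i x = ∑ k, pd (F k) i x :=
  fderiv_sum_apply hF _

theorem matrixDeriv_mul {A B : (Fin n → ℝ) → Matrix (Fin n) (Fin n) ℝ} {x : Fin n → ℝ}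
    (hA : ∀ i j, DifferentiableAt ℝ (fun y => A y i j) x)
    (hB : ∀ i j, DifferentiableAt ℝ (fun y => B y i j) x) (v : Fin n → ℝ) :
    matrixDeriv (fun y => A y * B y) v x = A x * matrixDeriv B v x + matrixDeriv A v x * B x := by
  ext i j
  simp only [matrixDeriv, Matrix.of_apply, Matrix.mul_apply, Matrix.add_apply]
  rw [fderiv_sum_apply (F := fun k y => A y i k * B y k j) fun k => (hA i k).mul (hB k j), ← Finset.sum_add_distrib]
  refine Finset.sum_congr rfl fun k _ => ?_
  rw [fderiv_mul_apply (hA i k) (hB k j)]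
  ring

namespace IsHomotheticOn

variable {g : (Fin n → ℝ) → Matrix (Fin n) (Fin n) ℝ} {Y : Fin n → (Fin n → ℝ) → ℝ} {ψ : ℝ}
  {U : Set (Fin n → ℝ)}

theorem smooth_adjugate (h : IsHomotheticOn g Y ψ U) (i j : Fin n) :
    ContDiffOn ℝ ∞ (fun x => (g x).adjugate i j) U := by
  simp only [Matrix.adjugate_apply, Matrix.det_apply']
  refine ContDiffOn.sum fun σ _ => contDiffOn_const.mul (contDiffOn_prod fun k _ => ?_)
  by_cases hk : σ k = j
  · simp only [Matrix.updateRow_apply, hk, if_true]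
    exact contDiffOn_const
  · simp only [Matrix.updateRow_apply, hk, if_false]
    exact h.smooth_metric _ _

theorem smooth_det (h : IsHomotheticOn g Y ψ U) : ContDiffOn ℝ ∞ (fun x => (g x).det) U := by
  simp only [Matrix.det_apply']
  exact ContDiffOn.sum fun σ _ => contDiffOn_const.mul
    (contDiffOn_prod fun k _ => h.smooth_metric _ _)

/-- Cramer's rule: the adjugate is polynomial in the entries of `g`, and the determinant does not
vanish on `U`. -/
theorem smooth_inv (h : IsHomotheticOn g Y ψ U) (i j : Fin n) :
    ContDiffOn ℝ ∞ (fun x => (g x)⁻¹ i j) U := by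
  simp only [Matrix.inv_def, Matrix.smul_apply, smul_eq_mul, Ring.inverse_eq_inv']
  exact (h.smooth_det.inv fun x hx => (h.isUnit_det x hx).ne_zero).mul (h.smooth_adjugate i j)

theorem inv_isSymm (h : IsHomotheticOn g Y ψ U) {x : Fin n → ℝ} (hx : x ∈ U) :
    ((g x)⁻¹).IsSymm := by
  rw [Matrix.IsSymm, Matrix.transpose_nonsing_inv, (h.isSymm x hx).eq]

theorem smooth_lowered (h : IsHomotheticOn g Y ψ U) (i : Fin n) :
    ContDiffOn ℝ ∞ (lowered g Y i) U :=
  ContDiffOn.sum fun j _ => (h.smooth_metric i j).mul (h.smooth_field j)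

theorem smooth_christoffelFirst (h : IsHomotheticOn g Y ψ U) (l j k : Fin n) :
    ContDiffOn ℝ ∞ (fun x => christoffelFirst g l x j k) U :=
  contDiffOn_const.mul (((pd_contDiffOn h.isOpen (h.smooth_metric _ _) _).add
    (pd_contDiffOn h.isOpen (h.smooth_metric _ _) _)).sub
    (pd_contDiffOn h.isOpen (h.smooth_metric _ _) _))

theorem smooth_potentialVariation (h : IsHomotheticOn g Y ψ U) {V : (Fin n → ℝ) → ℝ}
    (hV : ContDiffOn ℝ ∞ V U) : ContDiffOn ℝ ∞ (potentialVariation Y ψ V) U :=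
  (ContDiffOn.sum fun k _ => (h.smooth_field k).mul (pd_contDiffOn h.isOpen hV k)).add
    (contDiffOn_const.mul hV)

/-- The derivative of the metric along `Y`. -/
theorem matrixDeriv_metric (h : IsHomotheticOn g Y ψ U) {x : Fin n → ℝ} (hx : x ∈ U) :
    matrixDeriv g (fun k => Y k x) x
      = (2 * ψ) • g x - (jacobian Y x).transpose * g x - g x * jacobian Y x := by
  ext i j
  have := h.lieDeriv x hx i j
  simp only [lieDerivMetric, Finset.sum_add_distrib] at this
  simp only [matrixDeriv, Matrix.of_apply, Matrix.sub_apply, Matrix.smul_apply, smul_eq_mul,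
    Matrix.mul_apply, Matrix.transpose_apply, jacobian, fderiv_eq_sum_pd]
  rw [← this, Finset.sum_congr rfl fun k _ => mul_comm (g x k j) _]
  ring

/-- The derivative of the inverse metric along `Y`. -/
theorem matrixDeriv_inv (h : IsHomotheticOn g Y ψ U) {x : Fin n → ℝ} (hx : x ∈ U) :
    matrixDeriv (fun y => (g y)⁻¹) (fun k => Y k x) x
      = jacobian Y x * (g x)⁻¹ + (g x)⁻¹ * (jacobian Y x).transpose - (2 * ψ) • (g x)⁻¹ := by
  have hd := h.isUnit_det x hx
  have h1 := matrixDeriv_mul (A := fun y => (g y)⁻¹) (B := g) (x := x)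
    (fun i j => differentiableAt_of_contDiffOn h.isOpen (h.smooth_inv i j) hx)
    (fun i j => differentiableAt_of_contDiffOn h.isOpen (h.smooth_metric i j) hx)
    (fun k => Y k x)
  -- Differentiating `g⁻¹ g = 1`, which holds only on the open set `U`, expresses the derivative of
  -- `g⁻¹` through that of `g`.
  have h2 : matrixDeriv (fun y => (g y)⁻¹ * g y) (fun k => Y k x) x = 0 := by
    ext i j
    simp only [matrixDeriv, Matrix.of_apply, Matrix.zero_apply]
    rw [fderiv_congr_of_eqOn (G := fun _ => (1 : Matrix (Fin n) (Fin n) ℝ) i j) h.isOpen _ hx]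
    · simp
    · intro y hy
      simp only [Matrix.nonsing_inv_mul _ (h.isUnit_det y hy)]
  rw [h2, h.matrixDeriv_metric hx] at h1
  have h3 : matrixDeriv (fun y => (g y)⁻¹) (fun k => Y k x) x * g x
      = -((g x)⁻¹ * ((2 * ψ) • g x - (jacobian Y x).transpose * g x - g x * jacobian Y x)) :=
    eq_neg_of_add_eq_zero_right h1.symm
  have h4 := congrArg (· * (g x)⁻¹) h3
  simp only [Matrix.mul_assoc, Matrix.mul_nonsing_inv _ hd, Matrix.mul_one] at h4
  rw [h4]
  have e1 : (g x)⁻¹ * (g x * jacobian Y x) = jacobian Y x := by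
    rw [← Matrix.mul_assoc, Matrix.nonsing_inv_mul _ hd, Matrix.one_mul]
  simp only [Matrix.mul_sub, Matrix.mul_smul, e1, Matrix.nonsing_inv_mul _ hd, Matrix.neg_mul,
    Matrix.sub_mul, Matrix.smul_mul, Matrix.one_mul, Matrix.mul_assoc,
    Matrix.mul_nonsing_inv _ hd, Matrix.mul_one]
  abel

end IsHomotheticOn

end Coordinates

/-! ### Contracted Christoffel symbols and divergence under a homothetic field -/

section Coordinates

variable {n : ℕ}

/-- The contraction `g^{jk} Γ_{l,jk}`. -/
def christoffelFirstTrace (g : (Fin n → ℝ) → Matrix (Fin n) (Fin n) ℝ) (x : Fin n → ℝ)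
    (l : Fin n) : ℝ := ((g x)⁻¹ * christoffelFirst g l x).trace

/-- The Hessian matrix of `F`. -/
def hessian (F : (Fin n → ℝ) → ℝ) (x : Fin n → ℝ) : Matrix (Fin n) (Fin n) ℝ :=
  Matrix.of fun j k => pd (pd F j) k x

namespace IsHomotheticOn

variable {g : (Fin n → ℝ) → Matrix (Fin n) (Fin n) ℝ} {Y : Fin n → (Fin n → ℝ) → ℝ} {ψ : ℝ}
  {U : Set (Fin n → ℝ)}

theorem pd_metric_symm (h : IsHomotheticOn g Y ψ U) {x : Fin n → ℝ} (hx : x ∈ U)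
    (i j k : Fin n) : pd (fun y => g y i j) k x = pd (fun y => g y j i) k x := by
  rw [pd, fderiv_congr_of_eqOn h.isOpen (fun y hy => ((h.isSymm y hy).apply j i)) hx, pd]

theorem christoffelFirst_isSymm (h : IsHomotheticOn g Y ψ U) {x : Fin n → ℝ} (hx : x ∈ U)
    (l : Fin n) : (christoffelFirst g l x).IsSymm := by
  ext j k
  simp only [Matrix.transpose_apply, christoffelFirst, Matrix.of_apply]
  rw [h.pd_metric_symm hx k j]
  ring

/-- The derivative of `(L_Y g)_{ij} = 2 ψ g_{ij}`. -/
theorem pd_lieDeriv (h : IsHomotheticOn g Y ψ U) {x : Fin n → ℝ} (hx : x ∈ U)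
    (i j m : Fin n) :
    ∑ k, (pd (Y k) m x * pd (fun y => g y i j) k x + Y k x * pd (pd (fun y => g y i j) k) m x
      + (pd (fun y => g y k j) m x * pd (Y k) i x + g x k j * pd (pd (Y k) i) m x)
      + (pd (fun y => g y i k) m x * pd (Y k) j x + g x i k * pd (pd (Y k) j) m x))
      = 2 * ψ * pd (fun y => g y i j) m x := by
  have dY := fun k => differentiableAt_of_contDiffOn h.isOpen (h.smooth_field k) hx
  have dg := fun i j => differentiableAt_of_contDiffOn h.isOpen (h.smooth_metric i j) hx
  have dY' := fun k i => differentiableAt_of_contDiffOn h.isOpen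
    (pd_contDiffOn h.isOpen (h.smooth_field k) i) hx
  have dg' := fun i j k => differentiableAt_of_contDiffOn h.isOpen
    (pd_contDiffOn h.isOpen (h.smooth_metric i j) k) hx
  have e : pd (fun y => lieDerivMetric g Y i j y) m x = pd (fun y => 2 * ψ * g y i j) m x := by
    rw [pd, fderiv_congr_of_eqOn h.isOpen (fun y hy => h.lieDeriv y hy i j) hx, pd]
  rw [pd_mul (F := fun _ => 2 * ψ) (differentiableAt_const _) (dg i j)] at e
  simp only [lieDerivMetric] at e
  rw [pd_sum (F := fun k y => Y k y * pd (fun y => g y i j) k y + g y k j * pd (Y k) i y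
    + g y i k * pd (Y k) j y) (fun k => (((dY k).mul (dg' i j k)).add ((dg k j).mul (dY' k i))).add
      ((dg i k).mul (dY' k j)))] at e
  have c : pd (fun _ : Fin n → ℝ => 2 * ψ) m x = 0 := by simp [pd]
  rw [c, mul_zero, add_zero] at e
  rw [← e]
  refine Finset.sum_congr rfl fun k _ => ?_
  have a1 : HasFDerivAt _ _ x := ((dY k).hasFDerivAt.mul (dg' i j k).hasFDerivAt).add
    ((dg k j).hasFDerivAt.mul (dY' k i).hasFDerivAt) |>.add
      ((dg i k).hasFDerivAt.mul (dY' k j).hasFDerivAt)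
  have a2 := congrArg (fun φ => φ (Pi.single m 1)) a1.fderiv
  refine Eq.trans ?_ a2.symm
  simp [pd]
  ring

/-- The derivative of the Christoffel symbols of the first kind along `Y`. -/
theorem matrixDeriv_christoffelFirst (h : IsHomotheticOn g Y ψ U) {x : Fin n → ℝ} (hx : x ∈ U)
    (l : Fin n) :
    matrixDeriv (christoffelFirst g l) (fun k => Y k x) x
      = (2 * ψ) • christoffelFirst g l x - ∑ m, jacobian Y x m l • christoffelFirst g m x
        - (jacobian Y x).transpose * christoffelFirst g l x
        - christoffelFirst g l x * jacobian Y x - ∑ m, g x l m • hessian (Y m) x := by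
  ext j k
  simp only [matrixDeriv, Matrix.of_apply, Matrix.sub_apply, Matrix.smul_apply, smul_eq_mul,
    Matrix.sum_apply, Matrix.mul_apply, Matrix.transpose_apply, jacobian, hessian,
    fderiv_eq_sum_pd]
  have dg' := fun i j k => differentiableAt_of_contDiffOn h.isOpen
    (pd_contDiffOn h.isOpen (h.smooth_metric i j) k) hx
  have c := fun i j k m => pd_comm h.isOpen (h.smooth_metric i j) hx k m
  have cY := fun i k m => pd_comm h.isOpen (h.smooth_field i) hx k m
  have e1 : ∀ m, pd (fun y => christoffelFirst g l y j k) m x = (1 / 2) *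
      (pd (pd (fun y => g y l j) k) m x + pd (pd (fun y => g y l k) j) m x
        - pd (pd (fun y => g y j k) l) m x) := fun m => by
    have a1 : HasFDerivAt _ _ x := (((dg' l j k).hasFDerivAt.add (dg' l k j).hasFDerivAt).sub
      (dg' j k l).hasFDerivAt).const_mul (1 / 2)
    have a2 := congrArg (fun φ => φ (Pi.single m 1)) a1.fderiv
    refine Eq.trans a2 ?_
    simp [pd]
  -- The homothetic equation is differentiated in the three index patterns that define `Γ_{l,jk}`;
  -- half of `E1 + E2 - E3`, after exchanging mixed partials, is the claim.
  have E1 := h.pd_lieDeriv hx l j k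
  have E2 := h.pd_lieDeriv hx l k j
  have E3 := h.pd_lieDeriv hx j k l
  have key : ∑ m, (Y m x * pd (fun y => christoffelFirst g l y j k) m x
      + pd (Y m) l x * christoffelFirst g m x j k + pd (Y m) j x * christoffelFirst g l x m k
      + christoffelFirst g l x j m * pd (Y m) k x + g x l m * pd (pd (Y m) j) k x)
      = 2 * ψ * christoffelFirst g l x j k := by
    have : 2 * ψ * christoffelFirst g l x j k = (1 / 2) * (2 * ψ * pd (fun y => g y l j) k x
        + 2 * ψ * pd (fun y => g y l k) j x - 2 * ψ * pd (fun y => g y j k) l x) := by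
      simp only [christoffelFirst, Matrix.of_apply]
      ring
    rw [this, ← E1, ← E2, ← E3, ← Finset.sum_add_distrib, ← Finset.sum_sub_distrib,
      Finset.mul_sum]
    refine Finset.sum_congr rfl fun m _ => ?_
    rw [e1]
    simp only [christoffelFirst, Matrix.of_apply]
    rw [c l j m k, c l k m j, c j k m l, cY m k j, cY m k l, cY m j l,
      (h.isSymm x hx).apply j m, h.pd_metric_symm hx j m l]
    ring
  simp only [Finset.sum_add_distrib] at key
  linarith

/-- Raising the first index commutes with contracting the other two. The symbols of the first kind
are linear in the derivatives of `g`, so their variation along `Y` can be computed first and the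
inverse metric brought in afterwards. -/
theorem christoffelTrace_eq (h : IsHomotheticOn g Y ψ U) {x : Fin n → ℝ} (hx : x ∈ U)
    (i : Fin n) :
    christoffelTrace g i x = ((g x)⁻¹).mulVec (christoffelFirstTrace g x) i := by
  have e : ∀ l, christoffelFirstTrace g x l
      = ∑ j, ∑ k, (g x)⁻¹ j k * christoffelFirst g l x j k := fun l => by
    simp only [christoffelFirstTrace, Matrix.trace, Matrix.diag_apply, Matrix.mul_apply]
    exact Finset.sum_congr rfl fun j _ => Finset.sum_congr rfl fun k _ => by
      rw [(h.christoffelFirst_isSymm hx l).apply j k]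
  simp only [Matrix.mulVec, dotProduct, e, Finset.mul_sum]
  rw [Finset.sum_comm]
  refine Finset.sum_congr rfl fun j _ => ?_
  rw [Finset.sum_comm]
  refine Finset.sum_congr rfl fun k _ => ?_
  simp only [christoffel, Finset.mul_sum, christoffelFirst, Matrix.of_apply]
  exact Finset.sum_congr rfl fun l _ => by ring

theorem smooth_christoffelFirstTrace (h : IsHomotheticOn g Y ψ U) (l : Fin n) :
    ContDiffOn ℝ ∞ (fun x => christoffelFirstTrace g x l) U := by
  simp only [christoffelFirstTrace, Matrix.trace, Matrix.diag_apply, Matrix.mul_apply]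
  exact ContDiffOn.sum fun j _ => ContDiffOn.sum fun k _ =>
    (h.smooth_inv j k).mul (h.smooth_christoffelFirst l k j)

theorem smooth_christoffelTrace (h : IsHomotheticOn g Y ψ U) (i : Fin n) :
    ContDiffOn ℝ ∞ (christoffelTrace g i) U := by
  refine ContDiffOn.congr (f := fun x => ((g x)⁻¹).mulVec (christoffelFirstTrace g x) i) ?_
    fun x hx => h.christoffelTrace_eq hx i
  simp only [Matrix.mulVec, dotProduct]
  exact ContDiffOn.sum fun l _ => (h.smooth_inv i l).mul (h.smooth_christoffelFirstTrace l)

/-- Product rule on `tr (g⁻¹ Γ_l)`. By cyclicity of the trace, the Jacobian terms coming from `g⁻¹`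
cancel those acting on `j, k` in `Γ_{l,jk}`, and the two contributions of `2ψ` cancel as well. What
survives is the action on the free index `l` and the second derivatives of `Y`. -/
theorem fderiv_christoffelFirstTrace (h : IsHomotheticOn g Y ψ U) {x : Fin n → ℝ} (hx : x ∈ U)
    (l : Fin n) :
    fderiv ℝ (fun y => christoffelFirstTrace g y l) x (fun k => Y k x)
      = -((jacobian Y x).transpose.mulVec (christoffelFirstTrace g x) l)
        - (g x).mulVec (fun m => ((g x)⁻¹ * hessian (Y m) x).trace) l := by
  have dP := fun i j => differentiableAt_of_contDiffOn h.isOpen (h.smooth_inv i j) hx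
  have dC := fun i j => differentiableAt_of_contDiffOn h.isOpen
    (h.smooth_christoffelFirst l i j) hx
  have e1 : fderiv ℝ (fun y => christoffelFirstTrace g y l) x (fun k => Y k x)
      = (matrixDeriv (fun y => (g y)⁻¹ * christoffelFirst g l y) (fun k => Y k x) x).trace := by
    simp only [christoffelFirstTrace, Matrix.trace, Matrix.diag_apply]
    rw [fderiv_sum_apply]
    · rfl
    · intro i
      simp only [Matrix.mul_apply]
      exact DifferentiableAt.fun_sum fun k _ => (dP i k).mul (dC k i)
  rw [e1, matrixDeriv_mul (A := fun y => (g y)⁻¹) dP dC, h.matrixDeriv_inv hx,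
    h.matrixDeriv_christoffelFirst hx]
  simp only [Matrix.mul_sub, Matrix.sub_mul, Matrix.add_mul, Matrix.trace_add, Matrix.trace_sub,
    Matrix.mul_smul, Matrix.smul_mul, Matrix.trace_smul, Matrix.mul_sum, Matrix.trace_sum,
    Matrix.mulVec, dotProduct, smul_eq_mul, Matrix.transpose_apply, christoffelFirstTrace]
  rw [← Matrix.mul_assoc ((g x)⁻¹) (christoffelFirst g l x) (jacobian Y x),
    Matrix.trace_mul_comm _ (jacobian Y x), Matrix.mul_assoc (jacobian Y x),
    Matrix.mul_assoc (g x)⁻¹ (jacobian Y x).transpose]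
  ring

/-- A homothetic vector field preserves the contracted Christoffel symbols up to its factor. -/
theorem fderiv_christoffelTrace (h : IsHomotheticOn g Y ψ U) {x : Fin n → ℝ} (hx : x ∈ U)
    (i : Fin n) :
    fderiv ℝ (christoffelTrace g i) x (fun k => Y k x)
      = ∑ j, pd (Y i) j x * christoffelTrace g j x - 2 * ψ * christoffelTrace g i x
        - ∑ j, ∑ k, (g x)⁻¹ j k * pd (pd (Y i) j) k x := by
  have hd := h.isUnit_det x hx
  have dP := fun i j => differentiableAt_of_contDiffOn h.isOpen (h.smooth_inv i j) hx
  have dC := fun l => differentiableAt_of_contDiffOn h.isOpen (h.smooth_christoffelFirstTrace l) hx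
  rw [fderiv_congr_of_eqOn h.isOpen (fun y hy => h.christoffelTrace_eq hy i) hx]
  simp only [h.christoffelTrace_eq hx]
  have e1 : fderiv ℝ (fun y => ((g y)⁻¹).mulVec (christoffelFirstTrace g y) i) x (fun k => Y k x)
      = ((g x)⁻¹).mulVec (fun l => fderiv ℝ (fun y => christoffelFirstTrace g y l) x
          (fun k => Y k x)) i
        + (matrixDeriv (fun y => (g y)⁻¹) (fun k => Y k x) x).mulVec
          (christoffelFirstTrace g x) i := by
    simp only [Matrix.mulVec, dotProduct]
    rw [fderiv_sum_apply (F := fun l y => (g y)⁻¹ i l * christoffelFirstTrace g y l)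
      fun l => (dP i l).mul (dC l), ← Finset.sum_add_distrib]
    refine Finset.sum_congr rfl fun l _ => ?_
    rw [fderiv_mul_apply (dP i l) (dC l)]
    simp only [matrixDeriv, Matrix.of_apply]
    ring
  have e2 : (fun l => fderiv ℝ (fun y => christoffelFirstTrace g y l) x (fun k => Y k x))
      = -((jacobian Y x).transpose.mulVec (christoffelFirstTrace g x))
        - (g x).mulVec (fun m => ((g x)⁻¹ * hessian (Y m) x).trace) := by
    ext l
    exact h.fderiv_christoffelFirstTrace hx l
  have e3 : ((g x)⁻¹ * hessian (Y i) x).trace = ∑ j, ∑ k, (g x)⁻¹ j k * pd (pd (Y i) j) k x := by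
    simp only [Matrix.trace, Matrix.diag_apply, Matrix.mul_apply, hessian, Matrix.of_apply]
    exact Finset.sum_congr rfl fun j _ => Finset.sum_congr rfl fun k _ => by
      rw [pd_comm h.isOpen (h.smooth_field i) hx]
  -- The transposed Jacobian occurs once with each sign and drops out. The second derivatives of `Y`
  -- remain because `Γⁱ` is not a tensor.
  rw [e1, e2, h.matrixDeriv_inv hx, ← e3]
  simp only [Matrix.mulVec_sub, Matrix.mulVec_neg, Matrix.mulVec_mulVec, Matrix.add_mulVec,
    Matrix.sub_mulVec, Matrix.smul_mulVec, Matrix.nonsing_inv_mul _ hd, Matrix.one_mulVec,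
    Pi.sub_apply, Pi.add_apply, Pi.neg_apply, Pi.smul_apply, smul_eq_mul]
  have e4 : ((jacobian Y x) * (g x)⁻¹).mulVec (christoffelFirstTrace g x) i
      = ∑ j, pd (Y i) j x * ((g x)⁻¹).mulVec (christoffelFirstTrace g x) j := by
    rw [← Matrix.mulVec_mulVec]
    rfl
  rw [e4]
  ring

/-- The divergence of a homothetic vector field. -/
theorem divergence_lowered (h : IsHomotheticOn g Y ψ U) {x : Fin n → ℝ} (hx : x ∈ U) :
    ∑ i, ∑ j, (g x)⁻¹ i j * pd (lowered g Y i) j x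
      - ∑ i, christoffelTrace g i x * lowered g Y i x = n * ψ := by
  have hd := h.isUnit_det x hx
  have dY := fun k => differentiableAt_of_contDiffOn h.isOpen (h.smooth_field k) hx
  have dg := fun i j => differentiableAt_of_contDiffOn h.isOpen (h.smooth_metric i j) hx
  have e1 : ∑ i, christoffelTrace g i x * lowered g Y i x
      = ∑ k, christoffelFirstTrace g x k * Y k x := by
    have a : (fun i => christoffelTrace g i x)
        = ((g x)⁻¹).mulVec (christoffelFirstTrace g x) := funext fun i => h.christoffelTrace_eq hx i
    have b : (fun i => lowered g Y i x) = (g x).mulVec fun k => Y k x := rfl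
    change (fun i => christoffelTrace g i x) ⬝ᵥ (fun i => lowered g Y i x) = _
    rw [a, b, Matrix.dotProduct_mulVec, ← Matrix.mulVec_transpose, (h.isSymm x hx).eq,
      Matrix.mulVec_mulVec, Matrix.mul_nonsing_inv _ hd, Matrix.one_mulVec]
    rfl
  have e2 : ∀ i j, pd (lowered g Y i) j x
      = (g x * jacobian Y x) i j + ∑ k, Y k x * pd (fun y => g y i k) j x := fun i j => by
    change pd (fun y => ∑ k, g y i k * Y k y) j x = _
    rw [pd_sum (F := fun k y => g y i k * Y k y) fun k => (dg i k).mul (dY k), Matrix.mul_apply,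
      ← Finset.sum_add_distrib]
    exact Finset.sum_congr rfl fun k _ => pd_mul (dg i k) (dY k) j
  have e3 : ∀ A : Matrix (Fin n) (Fin n) ℝ, ∑ i, ∑ j, (g x)⁻¹ i j * A i j
      = ((g x)⁻¹ * A).trace := fun A => by
    simp only [Matrix.trace, Matrix.diag_apply, Matrix.mul_apply]
    rw [Finset.sum_comm]
    exact Finset.sum_congr rfl fun j _ => Finset.sum_congr rfl fun k _ => by
      rw [(h.inv_isSymm hx).apply j k]
  -- This is `g^{ij} g_{ik,j} - g^{ij} Γ_{k,ij} = ½ g^{ij} g_{ij,k}` contracted with `Yᵏ`. The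
  -- homothetic equation turns the right-hand side into `nψ - tr J`, with `J` the Jacobian of `Y`,
  -- and the other part of the divergence is `tr J`.
  have e4 : ∑ i, ∑ j, (g x)⁻¹ i j * ∑ k, Y k x * pd (fun y => g y i k) j x
      - ∑ k, christoffelFirstTrace g x k * Y k x
      = (1 / 2) * ((g x)⁻¹ * matrixDeriv g (fun k => Y k x) x).trace := by
    have f1 : ∀ k, christoffelFirstTrace g x k = ∑ i, ∑ j, (g x)⁻¹ i j * pd (fun y => g y i k) j x
        - (1 / 2) * ∑ i, ∑ j, (g x)⁻¹ i j * pd (fun y => g y i j) k x := fun k => by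
      have f2 : ∑ i, ∑ j, (g x)⁻¹ i j * pd (fun y => g y i k) j x
          = ∑ i, ∑ j, (g x)⁻¹ i j * pd (fun y => g y j k) i x := by
        rw [Finset.sum_comm]
        exact Finset.sum_congr rfl fun j _ => Finset.sum_congr rfl fun k _ => by
          rw [(h.inv_isSymm hx).apply j k]
      rw [christoffelFirstTrace, ← e3]
      have f3 : ∑ i, ∑ j, (g x)⁻¹ i j * pd (fun y => g y i k) j x
          = (1 / 2) * ∑ i, ∑ j, (g x)⁻¹ i j * pd (fun y => g y i k) j x
            + (1 / 2) * ∑ i, ∑ j, (g x)⁻¹ i j * pd (fun y => g y j k) i x := by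
        rw [← f2]
        ring
      rw [f3]
      simp only [Finset.mul_sum, ← Finset.sum_add_distrib, ← Finset.sum_sub_distrib]
      refine Finset.sum_congr rfl fun i _ => Finset.sum_congr rfl fun j _ => ?_
      simp only [christoffelFirst, Matrix.of_apply]
      rw [h.pd_metric_symm hx k i, h.pd_metric_symm hx k j]
      ring
    rw [← e3]
    simp only [f1, sub_mul, Finset.sum_sub_distrib, matrixDeriv, Matrix.of_apply,
      fderiv_eq_sum_pd]
    have f4 : ∑ i, ∑ j, (g x)⁻¹ i j * ∑ k, Y k x * pd (fun y => g y i k) j x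
        = ∑ k, (∑ i, ∑ j, (g x)⁻¹ i j * pd (fun y => g y i k) j x) * Y k x := by
      simp only [Finset.mul_sum, Finset.sum_mul]
      rw [Finset.sum_comm_cycle]
      refine Finset.sum_congr rfl fun k _ => ?_
      refine Finset.sum_congr rfl fun i _ => Finset.sum_congr rfl fun j _ => by ring
    have f5 : ∑ i, ∑ j, (g x)⁻¹ i j * ∑ k, Y k x * pd (fun y => g y i j) k x
        = ∑ k, (∑ i, ∑ j, (g x)⁻¹ i j * pd (fun y => g y i j) k x) * Y k x := by
      simp only [Finset.mul_sum, Finset.sum_mul]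
      rw [Finset.sum_comm_cycle]
      refine Finset.sum_congr rfl fun k _ => ?_
      refine Finset.sum_congr rfl fun i _ => Finset.sum_congr rfl fun j _ => by ring
    rw [f4, f5, Finset.mul_sum]
    have f6 : ∀ a b : Fin n → ℝ, ∑ k, a k - (∑ k, a k - ∑ k, b k) = ∑ k, b k := fun a b => by ring
    rw [f6]
    exact Finset.sum_congr rfl fun k _ => by ring
  have e5 : ((g x)⁻¹ * ((jacobian Y x).transpose * g x)).trace = (jacobian Y x).trace := by
    rw [← Matrix.mul_assoc, Matrix.trace_mul_comm, ← Matrix.mul_assoc,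
      Matrix.mul_nonsing_inv _ hd, Matrix.one_mul, Matrix.trace_transpose]
  have e6 : ((g x)⁻¹ * (g x * jacobian Y x)).trace = (jacobian Y x).trace := by
    rw [← Matrix.mul_assoc, Matrix.nonsing_inv_mul _ hd, Matrix.one_mul]
  simp only [e2, mul_add, Finset.sum_add_distrib]
  rw [e3, e1, add_sub_assoc, e4, h.matrixDeriv_metric hx]
  simp only [Matrix.mul_sub, Matrix.trace_sub, e5, e6, Matrix.mul_smul, Matrix.trace_smul,
    Matrix.nonsing_inv_mul _ hd, Matrix.trace_one, Fintype.card_fin, smul_eq_mul]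
  ring

end IsHomotheticOn

end Coordinates

theorem hasFDerivAt_of_eq_clm {E F : Type*} [NormedAddCommGroup E] [NormedSpace ℝ E]
    [NormedAddCommGroup F] [NormedSpace ℝ F] {f : E → F} (A : E →L[ℝ] F) (h : ∀ y, A y = f y)
    (x : E) : HasFDerivAt f A x :=
  (funext h : ⇑A = f) ▸ A.hasFDerivAt

/-! ### Second prolongations -/

section Prolongation

variable {ι : Type} [Fintype ι] [DecidableEq ι]

/-- `D_i F` pairs the differential of `F` at `(z, u)` with the vector `(e_i, p_i)`, and both depend
on the jet. Hence there is a second-derivative term, and an `F_{,u}` term from the variation of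
`p_i`. -/
theorem hasFDerivAt_totalDeriv0 {F : (ι → ℝ) × ℝ → ℝ} {U : Set (ι → ℝ)} (hU : IsOpen U)
    (hF : ContDiffOn ℝ ∞ F (U ×ˢ Set.univ)) (i : ι) {J : Jet1 ι} (hJ : J.1 ∈ U) :
    ∃ D : Jet1 ι →L[ℝ] ℝ, HasFDerivAt (totalDeriv0 F i) D J ∧ ∀ d : Jet1 ι,
      D d = fderiv ℝ (fderiv ℝ F) (J.1, J.2.1) (d.1, d.2.1) (Pi.single i 1, J.2.2 i)
        + d.2.2 i * fderiv ℝ F (J.1, J.2.1) (0, 1) := by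
  have hw : (J.1, J.2.1) ∈ U ×ˢ (Set.univ : Set ℝ) := ⟨hJ, trivial⟩
  have hd := (differentiableAt_fderiv_of_contDiffOn (hU.prod isOpen_univ) hF hw).hasFDerivAt
  have hπ : HasFDerivAt (fun J : Jet1 ι => (J.1, J.2.1))
      ((ContinuousLinearMap.fst ℝ _ _).prod
        ((ContinuousLinearMap.fst ℝ _ _).comp (ContinuousLinearMap.snd ℝ (ι → ℝ) _))) J :=
    by apply hasFDerivAt_of_eq_clm; exact fun _ => rfl
  have hp : HasFDerivAt (fun J : Jet1 ι => J.2.2 i)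
      ((ContinuousLinearMap.proj i).comp
        ((ContinuousLinearMap.snd ℝ _ _).comp (ContinuousLinearMap.snd ℝ (ι → ℝ) _))) J :=
    by apply hasFDerivAt_of_eq_clm; exact fun _ => rfl
  have hρ := (hasFDerivAt_const (Pi.single i (1 : ℝ) : ι → ℝ) J).prodMk hp
  refine ⟨_, (hd.comp J hπ).clm_apply hρ, fun d => ?_⟩
  have e : ((0 : ι → ℝ), d.2.2 i) = d.2.2 i • ((0 : ι → ℝ), (1 : ℝ)) := by simp
  simp only [_root_.add_apply, ContinuousLinearMap.comp_apply,
    ContinuousLinearMap.flip_apply, ContinuousLinearMap.prod_apply,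
    _root_.zero_apply, ContinuousLinearMap.coe_fst', ContinuousLinearMap.coe_snd',
    ContinuousLinearMap.proj_apply]
  rw [e, map_smul, smul_eq_mul, add_comm]

theorem totalDeriv1_totalDeriv0 {F : (ι → ℝ) × ℝ → ℝ} {U : Set (ι → ℝ)} (hU : IsOpen U)
    (hF : ContDiffOn ℝ ∞ F (U ×ˢ Set.univ)) (i j : ι) {J : Jet2 ι} (hJ : J.1 ∈ U) :
    totalDeriv1 (totalDeriv0 F i) j J
      = fderiv ℝ (fderiv ℝ F) (J.1, J.2.1) (Pi.single j 1, J.2.2.1 j)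
          (Pi.single i 1, J.2.2.1 i)
        + J.2.2.2 i j * fderiv ℝ F (J.1, J.2.1) (0, 1) := by
  obtain ⟨D, hD, hD'⟩ := hasFDerivAt_totalDeriv0 hU hF i (J := (J.1, J.2.1, J.2.2.1)) hJ
  rw [totalDeriv1, hD.fderiv, hD']

theorem prolongCoeff2_eq {ξ : ι → (ι → ℝ) × ℝ → ℝ} {η : (ι → ℝ) × ℝ → ℝ} {U : Set (ι → ℝ)}
    (hU : IsOpen U) (hξ : ∀ k, ContDiffOn ℝ ∞ (ξ k) (U ×ˢ Set.univ))
    (hη : ContDiffOn ℝ ∞ η (U ×ˢ Set.univ)) (i j : ι) {J : Jet2 ι} (hJ : J.1 ∈ U) :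
    prolongCoeff2 ξ η i j J = totalDeriv1 (totalDeriv0 η i) j J
      - ∑ k, (J.2.2.2 k j * totalDeriv0 (ξ k) i (J.1, J.2.1, J.2.2.1)
        + J.2.2.1 k * totalDeriv1 (totalDeriv0 (ξ k) i) j J)
      - ∑ k, J.2.2.2 i k * totalDeriv0 (ξ k) j (J.1, J.2.1, J.2.2.1) := by
  rw [prolongCoeff2]
  congr 1
  have hd : ∀ {F : (ι → ℝ) × ℝ → ℝ}, ContDiffOn ℝ ∞ F (U ×ˢ Set.univ) →
      DifferentiableAt ℝ (totalDeriv0 F i) (J.1, J.2.1, J.2.2.1) := fun hF => by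
    obtain ⟨D, hD, -⟩ := hasFDerivAt_totalDeriv0 hU hF i (J := (J.1, J.2.1, J.2.2.1)) hJ
    exact hD.differentiableAt
  have hp : ∀ k, HasFDerivAt (fun J : Jet1 ι => J.2.2 k)
      ((ContinuousLinearMap.proj k).comp
        ((ContinuousLinearMap.snd ℝ _ _).comp (ContinuousLinearMap.snd ℝ (ι → ℝ) _)))
      (J.1, J.2.1, J.2.2.1) := fun k =>
    by apply hasFDerivAt_of_eq_clm; exact fun _ => rfl
  have e := (hd hη).hasFDerivAt.sub (HasFDerivAt.fun_sum (u := Finset.univ) fun k _ =>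
    (hp k).mul (hd (hξ k)).hasFDerivAt)
  have e' := congrArg (fun φ => φ (Pi.single j 1, J.2.2.1 j, fun k => J.2.2.2 k j)) e.fderiv
  refine Eq.trans e' ?_
  simp only [_root_.sub_apply, _root_.sum_apply,
    _root_.add_apply, _root_.smul_apply,
    ContinuousLinearMap.comp_apply, ContinuousLinearMap.coe_snd', ContinuousLinearMap.proj_apply,
    smul_eq_mul]
  congr 1
  refine Finset.sum_congr rfl fun k _ => ?_
  rw [add_comm, mul_comm (totalDeriv0 (ξ k) i _)]
  rfl

end Prolongation

/-! ### The prolongation of `ξ ∂_t + T(t) Yⁱ ∂_i + η ∂_u` applied to the Schrödinger equation -/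

section Schrodinger

variable {n : ℕ}

/-- The spatial part of `(t, x)`. -/
def spaceProj (n : ℕ) : (Option (Fin n) → ℝ) →L[ℝ] (Fin n → ℝ) :=
  ContinuousLinearMap.pi fun i => ContinuousLinearMap.proj (some i)

/-- The points `(t, x)` with `x ∈ U`. -/
def cylinder (U : Set (Fin n → ℝ)) : Set (Option (Fin n) → ℝ) :=
  {z | (fun i => z (some i)) ∈ U}

/-- The components of `ξ ∂_t + T(t) Yⁱ ∂_i`. -/
def liftedField (ξ : (Option (Fin n) → ℝ) × ℝ → ℝ) (T : ℝ → ℝ) (Y : Fin n → (Fin n → ℝ) → ℝ)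
    (a : Option (Fin n)) (w : (Option (Fin n) → ℝ) × ℝ) : ℝ :=
  a.elim (ξ w) fun i => T (w.1 none) * Y i fun k => w.1 (some k)

theorem isOpen_cylinder {U : Set (Fin n → ℝ)} (hU : IsOpen U) : IsOpen (cylinder U) :=
  hU.preimage (spaceProj n).continuous

theorem contDiffOn_space {F : (Fin n → ℝ) → ℝ} {U : Set (Fin n → ℝ)}
    (hF : ContDiffOn ℝ ∞ F U) :
    ContDiffOn ℝ ∞ (fun w : (Option (Fin n) → ℝ) × ℝ => F fun k => w.1 (some k))
      (cylinder U ×ˢ Set.univ) :=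
  hF.comp ((spaceProj n).contDiff.comp contDiff_fst).contDiffOn fun _ hw => hw.1

theorem contDiffOn_time {T : ℝ → ℝ} (hT : ContDiff ℝ ∞ T)
    (S : Set ((Option (Fin n) → ℝ) × ℝ)) :
    ContDiffOn ℝ ∞ (fun w : (Option (Fin n) → ℝ) × ℝ => T (w.1 none)) S :=
  (hT.comp ((ContinuousLinearMap.proj (R := ℝ) (φ := fun _ : Option (Fin n) => ℝ)
    none).contDiff.comp contDiff_fst)).contDiffOn

/-- The derivative of a product `T(t) F(x)`, pulled back along linear maps. -/
theorem hasFDerivAt_separated {E : Type*} [NormedAddCommGroup E] [NormedSpace ℝ E]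
    (τ : E →L[ℝ] ℝ) (π : E →L[ℝ] (Fin n → ℝ)) {T : ℝ → ℝ} {F : (Fin n → ℝ) → ℝ} {w : E}
    (hT : DifferentiableAt ℝ T (τ w)) (hF : DifferentiableAt ℝ F (π w)) :
    HasFDerivAt (fun y => T (τ y) * F (π y))
      (T (τ w) • (fderiv ℝ F (π w)).comp π + (F (π w) * deriv T (τ w)) • τ) w := by
  have h1 : HasFDerivAt (fun y => T (τ y)) _ w := hT.hasDerivAt.comp_hasFDerivAt w τ.hasFDerivAt
  have h2 : HasFDerivAt (fun y => F (π y)) _ w := hF.hasFDerivAt.comp w π.hasFDerivAt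
  refine (h1.mul h2).congr_fderiv ?_
  rw [smul_smul]

theorem fderiv_separated_point {T : ℝ → ℝ} {F : (Fin n → ℝ) → ℝ}
    {w : (Option (Fin n) → ℝ) × ℝ} (hT : DifferentiableAt ℝ T (w.1 none))
    (hF : DifferentiableAt ℝ F fun k => w.1 (some k)) (d : (Option (Fin n) → ℝ) × ℝ) :
    fderiv ℝ (fun w : (Option (Fin n) → ℝ) × ℝ => T (w.1 none) * F fun k => w.1 (some k)) w d
      = T (w.1 none) * fderiv ℝ F (fun k => w.1 (some k)) (fun k => d.1 (some k))
        + (F fun k => w.1 (some k)) * deriv T (w.1 none) * d.1 none := by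
  have h := hasFDerivAt_separated (w := w)
    ((ContinuousLinearMap.proj none).comp
      (ContinuousLinearMap.fst ℝ (Option (Fin n) → ℝ) ℝ))
    ((spaceProj n).comp (ContinuousLinearMap.fst ℝ (Option (Fin n) → ℝ) ℝ)) hT hF
  exact congrArg (fun φ => φ d) h.fderiv

theorem single_some_comp (i : Fin n) :
    (fun k => (Pi.single (some i) (1 : ℝ) : Option (Fin n) → ℝ) (some k)) = Pi.single i 1 := by
  ext k
  simp [Pi.single_apply]

theorem single_none_comp :
    (fun k => (Pi.single none (1 : ℝ) : Option (Fin n) → ℝ) (some k)) = (0 : Fin n → ℝ) := by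
  ext k
  simp

theorem totalDeriv0_separated_some {T : ℝ → ℝ} {F : (Fin n → ℝ) → ℝ}
    {J : Jet1 (Option (Fin n))} (hT : DifferentiableAt ℝ T (J.1 none))
    (hF : DifferentiableAt ℝ F fun k => J.1 (some k)) (i : Fin n) :
    totalDeriv0 (fun w => T (w.1 none) * F fun k => w.1 (some k)) (some i) J
      = T (J.1 none) * pd F i fun k => J.1 (some k) := by
  rw [totalDeriv0, fderiv_separated_point hT hF]
  simp only [single_some_comp]
  simp [pd]

theorem totalDeriv0_separated_none {T : ℝ → ℝ} {F : (Fin n → ℝ) → ℝ}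
    {J : Jet1 (Option (Fin n))} (hT : DifferentiableAt ℝ T (J.1 none))
    (hF : DifferentiableAt ℝ F fun k => J.1 (some k)) :
    totalDeriv0 (fun w => T (w.1 none) * F fun k => w.1 (some k)) none J
      = deriv T (J.1 none) * F fun k => J.1 (some k) := by
  rw [totalDeriv0, fderiv_separated_point hT hF]
  simp only [single_none_comp]
  simp [mul_comm]

theorem totalDeriv1_separated {T : ℝ → ℝ} (hT : Differentiable ℝ T) {F : (Fin n → ℝ) → ℝ}
    {U : Set (Fin n → ℝ)} (hU : IsOpen U) (hF : ContDiffOn ℝ ∞ F U)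
    {J : Jet2 (Option (Fin n))} (hJ : J.1 ∈ cylinder U) (i j : Fin n) :
    totalDeriv1 (totalDeriv0 (fun w => T (w.1 none) * F fun k => w.1 (some k)) (some i))
      (some j) J = T (J.1 none) * pd (pd F i) j fun k => J.1 (some k) := by
  have e : fderiv ℝ (totalDeriv0 (fun w => T (w.1 none) * F fun k => w.1 (some k)) (some i))
      (J.1, J.2.1, J.2.2.1) = fderiv ℝ (fun J : Jet1 (Option (Fin n)) =>
        T (J.1 none) * pd F i fun k => J.1 (some k)) (J.1, J.2.1, J.2.2.1) :=
    fderiv_congr_of_eqOn ((isOpen_cylinder hU).preimage continuous_fst)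
      (fun y hy => totalDeriv0_separated_some (hT _)
        (differentiableAt_of_contDiffOn hU hF hy) i) hJ
  rw [totalDeriv1, e]
  have h := hasFDerivAt_separated (w := ((J.1, J.2.1, J.2.2.1) : Jet1 (Option (Fin n))))
    ((ContinuousLinearMap.proj none).comp
      (ContinuousLinearMap.fst ℝ (Option (Fin n) → ℝ) _))
    ((spaceProj n).comp (ContinuousLinearMap.fst ℝ (Option (Fin n) → ℝ) _)) (hT _)
    (differentiableAt_of_contDiffOn hU (pd_contDiffOn hU hF i)
      (w := fun k => J.1 (some k)) hJ)
  refine (congrArg (fun φ => φ (Pi.single (some j) 1, J.2.2.1 (some j),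
    fun k => J.2.2.2 k (some j))) h.fderiv).trans ?_
  have e2 : spaceProj n (Pi.single (some j) 1) = Pi.single j 1 := single_some_comp j
  simp [e2, pd]
  left
  rfl

variable {g : (Fin n → ℝ) → Matrix (Fin n) (Fin n) ℝ} {Y : Fin n → (Fin n → ℝ) → ℝ} {ψ : ℝ}
  {U : Set (Fin n → ℝ)} {V : (Fin n → ℝ) → ℝ} {T : ℝ → ℝ}
  {ξ η : (Option (Fin n) → ℝ) × ℝ → ℝ}

theorem IsHomotheticOn.fderiv_schrodinger (h : IsHomotheticOn g Y ψ U)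
    (hV : ContDiffOn ℝ ∞ V U) {J : Jet2 (Option (Fin n))} (hJ : J.1 ∈ cylinder U)
    (d : Jet2 (Option (Fin n))) :
    fderiv ℝ (schrodinger g V) J d
      = (∑ i, ∑ j, ((g fun k => J.1 (some k))⁻¹ i j * d.2.2.2 (some i) (some j)
          + J.2.2.2 (some i) (some j) * fderiv ℝ (fun y => (g y)⁻¹ i j)
            (fun k => J.1 (some k)) (fun k => d.1 (some k))))
        - (∑ i, (christoffelTrace g i (fun k => J.1 (some k)) * d.2.2.1 (some i)
          + J.2.2.1 (some i) * fderiv ℝ (christoffelTrace g i)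
            (fun k => J.1 (some k)) (fun k => d.1 (some k))))
        - d.2.2.1 none
        - (V (fun k => J.1 (some k)) * d.2.1
          + J.2.1 * fderiv ℝ V (fun k => J.1 (some k)) (fun k => d.1 (some k))) := by
  have hx : HasFDerivAt (fun J : Jet2 (Option (Fin n)) => fun k => J.1 (some k))
      ((spaceProj n).comp (ContinuousLinearMap.fst ℝ (Option (Fin n) → ℝ) _)) J :=
    by apply hasFDerivAt_of_eq_clm; exact fun _ => rfl
  have hu : HasFDerivAt (fun J : Jet2 (Option (Fin n)) => J.2.1)
      ((ContinuousLinearMap.fst ℝ _ _).comp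
        (ContinuousLinearMap.snd ℝ (Option (Fin n) → ℝ) _)) J :=
    by apply hasFDerivAt_of_eq_clm; exact fun _ => rfl
  have hp : ∀ a, HasFDerivAt (fun J : Jet2 (Option (Fin n)) => J.2.2.1 a)
      ((ContinuousLinearMap.proj a).comp ((ContinuousLinearMap.fst ℝ _ _).comp
        ((ContinuousLinearMap.snd ℝ _ _).comp
          (ContinuousLinearMap.snd ℝ (Option (Fin n) → ℝ) _)))) J := fun a =>
    by apply hasFDerivAt_of_eq_clm; exact fun _ => rfl
  have hq : ∀ a b, HasFDerivAt (fun J : Jet2 (Option (Fin n)) => J.2.2.2 a b)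
      ((ContinuousLinearMap.proj (R := ℝ) (φ := fun _ : Option (Fin n) => ℝ) b).comp
        ((ContinuousLinearMap.proj (R := ℝ) (φ := fun _ : Option (Fin n) => Option (Fin n) → ℝ)
          a).comp ((ContinuousLinearMap.snd ℝ _ _).comp ((ContinuousLinearMap.snd ℝ _ _).comp
          (ContinuousLinearMap.snd ℝ (Option (Fin n) → ℝ) _))))) J := fun a b =>
    by apply hasFDerivAt_of_eq_clm; exact fun _ => rfl
  have hc : ∀ {F : (Fin n → ℝ) → ℝ}, ContDiffOn ℝ ∞ F U →
      HasFDerivAt (fun J : Jet2 (Option (Fin n)) => F fun k => J.1 (some k))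
        ((fderiv ℝ F fun k => J.1 (some k)).comp
          ((spaceProj n).comp (ContinuousLinearMap.fst ℝ (Option (Fin n) → ℝ) _))) J :=
    fun hF => (differentiableAt_of_contDiffOn h.isOpen hF hJ).hasFDerivAt.comp J hx
  have e := (((HasFDerivAt.fun_sum (u := Finset.univ) fun i _ =>
      HasFDerivAt.fun_sum (u := Finset.univ) fun j _ =>
        (hc (h.smooth_inv i j)).mul (hq (some i) (some j))).sub
      (HasFDerivAt.fun_sum (u := Finset.univ) fun i _ =>
        (hc (h.smooth_christoffelTrace i)).mul (hp (some i)))).sub (hp none)).sub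
      ((hc hV).mul hu)
  refine (congrArg (fun φ => φ d) e.fderiv).trans ?_
  simp only [_root_.sub_apply, _root_.sum_apply,
    _root_.add_apply, _root_.smul_apply,
    ContinuousLinearMap.comp_apply, ContinuousLinearMap.coe_snd', ContinuousLinearMap.coe_fst',
    ContinuousLinearMap.proj_apply, smul_eq_mul]
  rfl

theorem IsHomotheticOn.contDiffOn_liftedField (h : IsHomotheticOn g Y ψ U)
    (hT : ContDiff ℝ ∞ T) (hξ : ContDiffOn ℝ ∞ ξ (cylinder U ×ˢ Set.univ))
    (a : Option (Fin n)) : ContDiffOn ℝ ∞ (liftedField ξ T Y a) (cylinder U ×ˢ Set.univ) := by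
  cases a with
  | none => exact hξ
  | some i => exact (contDiffOn_time hT _).mul (contDiffOn_space (h.smooth_field i))

/-- The second prolongation of `ξ ∂_t + T(t) Yⁱ ∂_i + η ∂_u` applied to the Schrödinger equation,
for a homothetic vector field `Y`. -/
theorem IsHomotheticOn.prolong2_schrodinger (h : IsHomotheticOn g Y ψ U)
    (hV : ContDiffOn ℝ ∞ V U) (hT : ContDiff ℝ ∞ T)
    (hξ : ContDiffOn ℝ ∞ ξ (cylinder U ×ˢ Set.univ))
    (hη : ContDiffOn ℝ ∞ η (cylinder U ×ˢ Set.univ))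
    {z : Option (Fin n) → ℝ} (hz : z ∈ cylinder U) (u : ℝ) (p : Option (Fin n) → ℝ)
    (q : Option (Fin n) → Option (Fin n) → ℝ) {x : Fin n → ℝ} (hx : x = fun k => z (some k)) :
    prolong2 (liftedField ξ T Y) η (schrodinger g V) (z, u, p, q)
      = ∑ i, ∑ j, (g x)⁻¹ i j
          * totalDeriv1 (totalDeriv0 η (some i)) (some j) (z, u, p, q)
        - ∑ i, christoffelTrace g i x * totalDeriv0 η (some i) (z, u, p)
        - totalDeriv0 η none (z, u, p) - V x * η (z, u)
        - 2 * ψ * T (z none) * (∑ i, ∑ j, (g x)⁻¹ i j * q (some i) (some j)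
          - ∑ i, christoffelTrace g i x * p (some i))
        + deriv T (z none) * ∑ i, Y i x * p (some i)
        - T (z none) * (∑ i, Y i x * pd V i x) * u
        + p none * totalDeriv0 ξ none (z, u, p)
        - (∑ i, ∑ j, (g x)⁻¹ i j * (q none (some j) * totalDeriv0 ξ (some i) (z, u, p)
            + q (some i) none * totalDeriv0 ξ (some j) (z, u, p)
            + p none * totalDeriv1 (totalDeriv0 ξ (some i)) (some j) (z, u, p, q)))
        + p none * ∑ i, christoffelTrace g i x * totalDeriv0 ξ (some i) (z, u, p) := by
  have hxU : x ∈ U := hx ▸ hz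
  have dT : Differentiable ℝ T := hT.differentiable (by simp)
  have dY := fun k => differentiableAt_of_contDiffOn h.isOpen (h.smooth_field k) hxU
  have hs : ∀ k, liftedField ξ T Y (some k)
      = fun w => T (w.1 none) * Y k fun i => w.1 (some i) := fun k => rfl
  have hn : liftedField ξ T Y none = ξ := rfl
  have c1s : ∀ i, prolongCoeff1 (liftedField ξ T Y) η (some i) (z, u, p)
      = totalDeriv0 η (some i) (z, u, p) - p none * totalDeriv0 ξ (some i) (z, u, p)
        - T (z none) * ∑ k, p (some k) * pd (Y k) i x := fun i => by
    rw [prolongCoeff1, Fintype.sum_option, hn, Finset.mul_sum, ← sub_sub]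
    congr 1
    refine Finset.sum_congr rfl fun k _ => ?_
    rw [hs, totalDeriv0_separated_some (dT _) (by subst hx; exact dY k), hx]
    ring
  have c1n : prolongCoeff1 (liftedField ξ T Y) η none (z, u, p)
      = totalDeriv0 η none (z, u, p) - p none * totalDeriv0 ξ none (z, u, p)
        - deriv T (z none) * ∑ k, Y k x * p (some k) := by
    rw [prolongCoeff1, Fintype.sum_option, hn, Finset.mul_sum, ← sub_sub]
    congr 1
    refine Finset.sum_congr rfl fun k _ => ?_
    rw [hs, totalDeriv0_separated_none (dT _) (by subst hx; exact dY k), hx]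
    ring
  have c2 : ∀ i j, prolongCoeff2 (liftedField ξ T Y) η (some i) (some j) (z, u, p, q)
      = totalDeriv1 (totalDeriv0 η (some i)) (some j) (z, u, p, q)
        - (q none (some j) * totalDeriv0 ξ (some i) (z, u, p)
            + q (some i) none * totalDeriv0 ξ (some j) (z, u, p)
            + p none * totalDeriv1 (totalDeriv0 ξ (some i)) (some j) (z, u, p, q))
        - T (z none) * ∑ k, (q (some k) (some j) * pd (Y k) i x
            + q (some i) (some k) * pd (Y k) j x)
        - T (z none) * ∑ k, p (some k) * pd (pd (Y k) i) j x := fun i j => by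
    rw [prolongCoeff2_eq (isOpen_cylinder h.isOpen) (h.contDiffOn_liftedField hT hξ) hη _ _ hz,
      Fintype.sum_option, Fintype.sum_option]
    have e1 : ∀ k i, totalDeriv0 (liftedField ξ T Y (some k)) (some i) (z, u, p)
        = T (z none) * pd (Y k) i x := fun k i => by
      rw [hs, totalDeriv0_separated_some (dT _) (by subst hx; exact dY k), hx]
    have e2 : ∀ k, totalDeriv1 (totalDeriv0 (liftedField ξ T Y (some k)) (some i)) (some j)
        (z, u, p, q) = T (z none) * pd (pd (Y k) i) j x := fun k => by
      rw [hs, totalDeriv1_separated dT h.isOpen (h.smooth_field k) hz, hx]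
    simp only [e1, e2, hn, Finset.sum_add_distrib, mul_add, Finset.mul_sum]
    have e3 : ∀ a b c : ℝ, a * (b * c) = b * (a * c) := fun a b c => by ring
    simp only [e3 (T (z none))]
    ring
  have hY : (fun k => liftedField ξ T Y (some k) (z, u)) = T (z none) • fun k => Y k x := by
    ext k
    simp [hs, hx]
  rw [prolong2, h.fderiv_schrodinger hV hz]
  simp only [← hx, c1n, c1s, c2, hY, map_smul, smul_eq_mul, h.fderiv_christoffelTrace hxU,
    fderiv_eq_sum_pd V]
  -- The variation of `g^{ij}` along `Y` reproduces the terms `u_{,kj} Yᵏ_{,i} + u_{,ik} Yᵏ_{,j}` of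
  -- the second prolongation with the opposite sign in the total, so only `-2ψ g^{ij} u_{,ij}` is
  -- left.
  have hq : ∑ i, ∑ j, q (some i) (some j)
        * fderiv ℝ (fun y => (g y)⁻¹ i j) x (fun k => Y k x)
      = ∑ i, ∑ j, (g x)⁻¹ i j * ∑ k, (q (some k) (some j) * pd (Y k) i x
            + q (some i) (some k) * pd (Y k) j x)
        - 2 * ψ * ∑ i, ∑ j, (g x)⁻¹ i j * q (some i) (some j) := by
    have e1 : ∀ i j, fderiv ℝ (fun y => (g y)⁻¹ i j) x (fun k => Y k x)
        = ∑ k, pd (Y i) k x * (g x)⁻¹ k j + ∑ k, (g x)⁻¹ i k * pd (Y j) k x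
          - 2 * ψ * (g x)⁻¹ i j := fun i j => by
      have := congrFun (congrFun (h.matrixDeriv_inv hxU) i) j
      simpa [matrixDeriv, Matrix.mul_apply, jacobian] using this
    simp only [e1, mul_sub, mul_add, Finset.sum_sub_distrib, Finset.sum_add_distrib,
      Finset.mul_sum]
    congr 1
    · congr 1
      · rw [Finset.sum_comm_cycle]
        refine Finset.sum_congr rfl fun k _ => ?_
        rw [Finset.sum_comm]
        exact Finset.sum_congr rfl fun j _ => Finset.sum_congr rfl fun i _ => by ring
      · refine Finset.sum_congr rfl fun i _ => ?_
        rw [Finset.sum_comm]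
        exact Finset.sum_congr rfl fun k _ => Finset.sum_congr rfl fun j _ => by ring
    · exact Finset.sum_congr rfl fun i _ => Finset.sum_congr rfl fun j _ => by ring
  -- The first-order counterpart: the variation of `Γⁱ` cancels the first derivatives of `Y` from
  -- the first prolongation and the second derivatives of `Y` from the second.
  have hp : ∑ i, p (some i) * (∑ j, pd (Y i) j x * christoffelTrace g j x
        - 2 * ψ * christoffelTrace g i x - ∑ j, ∑ k, (g x)⁻¹ j k * pd (pd (Y i) j) k x)
      = ∑ i, christoffelTrace g i x * ∑ k, p (some k) * pd (Y k) i x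
        - 2 * ψ * ∑ i, christoffelTrace g i x * p (some i)
        - ∑ i, ∑ j, (g x)⁻¹ i j * ∑ k, p (some k) * pd (pd (Y k) i) j x := by
    simp only [mul_sub, Finset.sum_sub_distrib, Finset.mul_sum]
    congr 1
    · congr 1
      · rw [Finset.sum_comm]
        exact Finset.sum_congr rfl fun j _ => Finset.sum_congr rfl fun i _ => by ring
      · exact Finset.sum_congr rfl fun i _ => by ring
    · conv_rhs => rw [Finset.sum_comm_cycle]
      refine Finset.sum_congr rfl fun k _ => ?_
      exact Finset.sum_congr rfl fun j _ => Finset.sum_congr rfl fun i _ => by ring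
  have e3 : ∀ a b c : ℝ, a * (b * c) = b * (a * c) := fun a b c => by ring
  simp only [e3 _ (T (z none)), mul_sub, Finset.sum_add_distrib, Finset.sum_sub_distrib,
    ← Finset.mul_sum, e3 _ (p none)] at hp ⊢
  have hYV : ∑ k, (T (z none) • fun k => Y k x) k * pd V k x
      = T (z none) * ∑ k, Y k x * pd V k x := by
    simp only [Pi.smul_apply, smul_eq_mul, mul_assoc, Finset.mul_sum]
  simp only [Finset.sum_add_distrib] at hq
  rw [hq, hYV]
  linear_combination -T (z none) * hp

end Schrodinger

section Schrodinger

variable {n : ℕ}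

variable {g : (Fin n → ℝ) → Matrix (Fin n) (Fin n) ℝ} {Y : Fin n → (Fin n → ℝ) → ℝ} {ψ : ℝ}
  {U : Set (Fin n → ℝ)} {V : (Fin n → ℝ) → ℝ} {T : ℝ → ℝ}
  {ξ η : (Option (Fin n) → ℝ) × ℝ → ℝ}

theorem fderiv_separated (i : Option (Fin n)) {S : ℝ → ℝ} {F : (Fin n → ℝ) → ℝ}
    {z : Option (Fin n) → ℝ} (hS : DifferentiableAt ℝ S (z none))
    (hF : DifferentiableAt ℝ F fun k => z (some k)) :
    fderiv ℝ (fun z : Option (Fin n) → ℝ => S (z none) * F fun k => z (some k)) z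
        (Pi.single i 1)
      = i.elim (deriv S (z none) * F fun k => z (some k))
        fun j => S (z none) * pd F j fun k => z (some k) := by
  have h := hasFDerivAt_separated (w := z) (ContinuousLinearMap.proj none) (spaceProj n) hS hF
  refine (congrArg (fun φ => φ (Pi.single i 1)) h.fderiv).trans ?_
  cases i with
  | none =>
    have e : spaceProj n (Pi.single none 1) = 0 := single_none_comp
    simp [e, mul_comm]
    left; rfl
  | some j =>
    have e : spaceProj n (Pi.single (some j) 1) = Pi.single j 1 := single_some_comp j
    simp [e, pd]
    left; rfl

theorem fderiv_slice {F : (Option (Fin n) → ℝ) × ℝ → ℝ} {Z : Set (Option (Fin n) → ℝ)}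
    (hZ : IsOpen Z) (hF : ContDiffOn ℝ ∞ F (Z ×ˢ Set.univ)) {z : Option (Fin n) → ℝ}
    (hz : z ∈ Z) (u : ℝ) (d : Option (Fin n) → ℝ) :
    fderiv ℝ (fun z => F (z, u)) z d = fderiv ℝ F (z, u) (d, 0) := by
  have h1 := (differentiableAt_of_contDiffOn (hZ.prod isOpen_univ) hF
    (w := (z, u)) ⟨hz, trivial⟩).hasFDerivAt
  have h2 : HasFDerivAt (fun z : Option (Fin n) → ℝ => (z, u)) _ z :=
    (hasFDerivAt_id (𝕜 := ℝ) z).prodMk (hasFDerivAt_const u z)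
  exact congrArg (fun φ => φ d) (h1.comp z h2).fderiv

theorem hasDerivAt_fiber {F : (Option (Fin n) → ℝ) × ℝ → ℝ} {Z : Set (Option (Fin n) → ℝ)}
    (hZ : IsOpen Z) (hF : ContDiffOn ℝ ∞ F (Z ×ˢ Set.univ)) {z : Option (Fin n) → ℝ}
    (hz : z ∈ Z) (u : ℝ) :
    HasDerivAt (fun u => F (z, u)) (fderiv ℝ F (z, u) (0, 1)) u := by
  have h1 := (differentiableAt_of_contDiffOn (hZ.prod isOpen_univ) hF
    (w := (z, u)) ⟨hz, trivial⟩).hasFDerivAt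
  have h2 : HasDerivAt (fun u : ℝ => (z, u)) (0, 1) u :=
    (hasDerivAt_const u z).prodMk (hasDerivAt_id u)
  exact h1.comp_hasDerivAt u h2

namespace IsHomotheticOn

theorem raise_lowered (h : IsHomotheticOn g Y ψ U) {x : Fin n → ℝ} (hx : x ∈ U) (i : Fin n) :
    ∑ j, (g x)⁻¹ i j * lowered g Y j x = Y i x := by
  have e : ((g x)⁻¹).mulVec ((g x).mulVec fun k => Y k x) i = Y i x := by
    rw [Matrix.mulVec_mulVec, Matrix.nonsing_inv_mul _ (h.isUnit_det x hx), Matrix.one_mulVec]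
  exact e

theorem raise_lowered' (h : IsHomotheticOn g Y ψ U) {x : Fin n → ℝ} (hx : x ∈ U) (j : Fin n) :
    ∑ i, (g x)⁻¹ i j * lowered g Y i x = Y j x := by
  rw [← h.raise_lowered hx j]
  exact Finset.sum_congr rfl fun k _ => by rw [(h.inv_isSymm hx).apply j k]

/-! ### Construction of Lie point symmetries -/

theorem totalDeriv0_linear {A : (Option (Fin n) → ℝ) → ℝ} {Z : Set (Option (Fin n) → ℝ)}
    (hZ : IsOpen Z) (hA : ContDiffOn ℝ ∞ A Z) (a : Option (Fin n)) {J : Jet1 (Option (Fin n))}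
    (hJ : J.1 ∈ Z) :
    totalDeriv0 (fun w => A w.1 * w.2) a J
      = fderiv ℝ A J.1 (Pi.single a 1) * J.2.1 + A J.1 * J.2.2 a := by
  have h1 : HasFDerivAt (fun w : (Option (Fin n) → ℝ) × ℝ => A w.1) _ (J.1, J.2.1) :=
    (differentiableAt_of_contDiffOn hZ hA hJ).hasFDerivAt.comp (J.1, J.2.1) hasFDerivAt_fst
  have h2 := h1.mul (hasFDerivAt_snd (𝕜 := ℝ) (p := (J.1, J.2.1)))
  rw [totalDeriv0]
  refine (congrArg (fun φ => φ (Pi.single a 1, J.2.2 a)) h2.fderiv).trans ?_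
  simp
  ring

theorem totalDeriv1_linear {A : (Option (Fin n) → ℝ) → ℝ} {Z : Set (Option (Fin n) → ℝ)}
    (hZ : IsOpen Z) (hA : ContDiffOn ℝ ∞ A Z) (a b : Option (Fin n))
    {J : Jet2 (Option (Fin n))} (hJ : J.1 ∈ Z) :
    totalDeriv1 (totalDeriv0 (fun w => A w.1 * w.2) a) b J
      = fderiv ℝ (fun z => fderiv ℝ A z (Pi.single a 1)) J.1 (Pi.single b 1) * J.2.1
        + fderiv ℝ A J.1 (Pi.single a 1) * J.2.2.1 b
        + fderiv ℝ A J.1 (Pi.single b 1) * J.2.2.1 a + A J.1 * J.2.2.2 a b := by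
  have e : fderiv ℝ (totalDeriv0 (fun w => A w.1 * w.2) a) (J.1, J.2.1, J.2.2.1)
      = fderiv ℝ (fun J : Jet1 (Option (Fin n)) =>
        fderiv ℝ A J.1 (Pi.single a 1) * J.2.1 + A J.1 * J.2.2 a) (J.1, J.2.1, J.2.2.1) :=
    fderiv_congr_of_eqOn (hZ.preimage continuous_fst)
      (fun y hy => totalDeriv0_linear hZ hA a hy) hJ
  rw [totalDeriv1, e]
  have hc : ∀ {F : (Option (Fin n) → ℝ) → ℝ}, ContDiffOn ℝ ∞ F Z →
      HasFDerivAt (fun J : Jet1 (Option (Fin n)) => F J.1)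
        ((fderiv ℝ F J.1).comp (ContinuousLinearMap.fst ℝ (Option (Fin n) → ℝ) _))
        (J.1, J.2.1, J.2.2.1) := fun hF =>
    (differentiableAt_of_contDiffOn hZ hF hJ).hasFDerivAt.comp (J.1, J.2.1, J.2.2.1)
      hasFDerivAt_fst
  have hu : HasFDerivAt (fun J : Jet1 (Option (Fin n)) => J.2.1)
      ((ContinuousLinearMap.fst ℝ _ _).comp
        (ContinuousLinearMap.snd ℝ (Option (Fin n) → ℝ) _)) (J.1, J.2.1, J.2.2.1) :=
    by apply hasFDerivAt_of_eq_clm; exact fun _ => rfl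
  have hp : HasFDerivAt (fun J : Jet1 (Option (Fin n)) => J.2.2 a)
      ((ContinuousLinearMap.proj a).comp ((ContinuousLinearMap.snd ℝ _ _).comp
          (ContinuousLinearMap.snd ℝ (Option (Fin n) → ℝ) _))) (J.1, J.2.1, J.2.2.1) :=
    by apply hasFDerivAt_of_eq_clm; exact fun _ => rfl
  have h2 := ((hc (fderiv_apply_contDiffOn hZ hA (Pi.single a 1))).mul hu).add ((hc hA).mul hp)
  refine (congrArg (fun φ => φ (Pi.single b 1, J.2.2.1 b, fun k => J.2.2.2 k b))
    h2.fderiv).trans ?_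
  simp
  ring

/-- The coefficients are forced by the determining equations. With `A = αW - ½ nψ T`, the relations
`∂_i W = c Y_i` and `T' = -2cα` give `A_i = -½ T' Y_i`, whose cross terms cancel `T' Yⁱ u_{,i}`. The
relation `α' = -T` gives the required `A_t`, and the constant `-½ nψ` compensates the divergence
`nψ` of `Y` inside `ΔA`. -/
theorem isLiePointSymmetryOn (h : IsHomotheticOn g Y ψ U) (hV : ContDiffOn ℝ ∞ V U)
    {c : ℝ} (hc : ∀ x ∈ U, ∀ i, pd (potentialVariation Y ψ V) i x = c * lowered g Y i x)
    {α : ℝ → ℝ} (hT : ContDiff ℝ ∞ T) (hα : ContDiff ℝ ∞ α) (hα' : ∀ t, deriv α t = -T t)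
    (hT' : ∀ t, deriv T t = -2 * c * α t) :
    IsLiePointSymmetryOn (schrodinger g V) (cylinder U)
      (liftedField (fun w => -2 * ψ * α (w.1 none)) T Y)
      (fun w => (α (w.1 none) * (potentialVariation Y ψ V fun k => w.1 (some k))
        + -(1 / 2) * n * ψ * T (w.1 none)) * w.2) := by
  set W := potentialVariation Y ψ V with hWdef
  set A : (Option (Fin n) → ℝ) → ℝ := fun z => α (z none) * (W fun k => z (some k))
        + -(1 / 2) * n * ψ * T (z none) with hAdef
  have hZ := isOpen_cylinder h.isOpen
  have hW : ContDiffOn ℝ ∞ W U := h.smooth_potentialVariation hV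
  have hτ : ∀ {S : ℝ → ℝ}, ContDiff ℝ ∞ S →
      ContDiffOn ℝ ∞ (fun z : Option (Fin n) → ℝ => S (z none)) (cylinder U) := fun hS =>
    (hS.comp (ContinuousLinearMap.proj (R := ℝ) (φ := fun _ : Option (Fin n) => ℝ)
      none).contDiff).contDiffOn
  have hA1 : ContDiffOn ℝ ∞ (fun z : Option (Fin n) → ℝ =>
      α (z none) * (W fun k => z (some k))) (cylinder U) :=
    (hτ hα).mul (hW.comp (spaceProj n).contDiff.contDiffOn fun _ hz => hz)
  have hA2 : ContDiffOn ℝ ∞ (fun z : Option (Fin n) → ℝ => -(1 / 2) * n * ψ * T (z none))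
      (cylinder U) := contDiffOn_const.mul (hτ hT)
  have hA : ContDiffOn ℝ ∞ A (cylinder U) := hA1.add hA2
  have hξ : ContDiffOn ℝ ∞ (fun w : (Option (Fin n) → ℝ) × ℝ => -2 * ψ * α (w.1 none))
      (cylinder U ×ˢ Set.univ) := contDiffOn_const.mul (contDiffOn_time hα _)
  have hη : ContDiffOn ℝ ∞ (fun w : (Option (Fin n) → ℝ) × ℝ => A w.1 * w.2)
      (cylinder U ×ˢ Set.univ) :=
    (hA.comp contDiffOn_fst fun _ hw => hw.1).mul contDiffOn_snd
  have dT : Differentiable ℝ T := hT.differentiable (by simp)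
  have dα : Differentiable ℝ α := hα.differentiable (by simp)
  have dW := fun x (hx : x ∈ U) => differentiableAt_of_contDiffOn h.isOpen hW hx
  have A_deriv : ∀ z ∈ cylinder U, ∀ a, fderiv ℝ A z (Pi.single a 1)
      = a.elim (deriv α (z none) * W fun k => z (some k))
          (fun j => α (z none) * pd W j fun k => z (some k))
        + a.elim (-(1 / 2) * n * ψ * deriv T (z none)) fun _ => 0 := fun z hz a => by
    rw [← fderiv_separated a (dα _) (dW _ hz)]
    have e : fderiv ℝ A z = _ := fderiv_fun_add (differentiableAt_of_contDiffOn hZ hA1 hz)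
      (differentiableAt_of_contDiffOn hZ hA2 hz)
    rw [e, _root_.add_apply]
    congr 1
    have e2 := fderiv_separated a (S := fun t => -(1 / 2) * n * ψ * T t)
      (F := fun _ => (1 : ℝ)) (z := z) ((dT _).const_mul _) (differentiableAt_const _)
    simp only [mul_one] at e2
    rw [e2]
    cases a with
    | none => simp [deriv_const_mul_field]
    | some j => simp [pd]
  have A_t : ∀ z ∈ cylinder U, fderiv ℝ A z (Pi.single none 1)
      = -T (z none) * (W fun k => z (some k)) - (1 / 2) * n * ψ * deriv T (z none) :=
    fun z hz => by
      rw [A_deriv z hz]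
      simp only [Option.elim, hα']
      ring
  have A_i : ∀ z ∈ cylinder U, ∀ i, fderiv ℝ A z (Pi.single (some i) 1)
      = -(1 / 2) * deriv T (z none) * lowered g Y i fun k => z (some k) := fun z hz i => by
    rw [A_deriv z hz]
    simp only [Option.elim, hT', hc _ hz]
    ring
  have dL := fun i x (hx : x ∈ U) => differentiableAt_of_contDiffOn h.isOpen
    (h.smooth_lowered i) hx
  have dT2 : Differentiable ℝ (deriv T) :=
    ((contDiff_infty_iff_deriv.1 hT).2).differentiable (by simp)
  have A_ij : ∀ z ∈ cylinder U, ∀ i j,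
      fderiv ℝ (fun z => fderiv ℝ A z (Pi.single (some i) 1)) z (Pi.single (some j) 1)
        = -(1 / 2) * deriv T (z none) * pd (lowered g Y i) j fun k => z (some k) :=
    fun z hz i j => by
      rw [fderiv_congr_of_eqOn hZ (fun z hz => A_i z hz i) hz,
        fderiv_separated (some j) (S := fun t => -(1 / 2) * deriv T t) ((dT2 _).const_mul _)
          (dL i _ hz)]
      rfl
  -- The multiplier can be read off the coefficient of `g^{ij} u_{,ij}`: `A` comes from `η`, and
  -- `-2ψT` from the rescaling of the metric.
  refine ⟨h.contDiffOn_liftedField hT hξ, hη, fun J => A J.1 - 2 * ψ * T (J.1 none), ?_⟩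
  rintro ⟨z, u, p, q⟩ hz -
  have hz : z ∈ cylinder U := hz
  rw [h.prolong2_schrodinger hV hT hξ hη hz u p q rfl]
  have hxU : (fun k => z (some k)) ∈ U := hz
  have S_eq : ∀ i j, totalDeriv1 (totalDeriv0 (fun w => A w.1 * w.2) (some i)) (some j)
      (z, u, p, q) = _ := fun i j => totalDeriv1_linear hZ hA (some i) (some j) hz
  have D_eq : ∀ a, totalDeriv0 (fun w => A w.1 * w.2) a (z, u, p) = _ :=
    fun a => totalDeriv0_linear hZ hA a (J := (z, u, p)) hz
  have ξ_eq : (fun w : (Option (Fin n) → ℝ) × ℝ => -2 * ψ * α (w.1 none))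
      = fun w => (fun t => -2 * ψ * α t) (w.1 none) *
        (fun _ : Fin n → ℝ => (1 : ℝ)) fun k => w.1 (some k) := by
    ext w
    simp
  have ξ_t : totalDeriv0 (fun w : (Option (Fin n) → ℝ) × ℝ => -2 * ψ * α (w.1 none)) none
      (z, u, p) = 2 * ψ * T (z none) := by
    rw [ξ_eq, totalDeriv0_separated_none ((dα _).const_mul _) (differentiableAt_const _)]
    simp [deriv_const_mul_field, hα']
  have ξ_i : ∀ i, totalDeriv0 (fun w : (Option (Fin n) → ℝ) × ℝ => -2 * ψ * α (w.1 none))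
      (some i) (z, u, p) = 0 := fun i => by
    rw [ξ_eq, totalDeriv0_separated_some ((dα _).const_mul _) (differentiableAt_const _)]
    simp [pd]
  have ξ_ij : ∀ i j, totalDeriv1 (totalDeriv0
      (fun w : (Option (Fin n) → ℝ) × ℝ => -2 * ψ * α (w.1 none)) (some i)) (some j)
      (z, u, p, q) = 0 := fun i j => by
    rw [ξ_eq, totalDeriv1_separated (T := fun t => -2 * ψ * α t) (dα.const_mul _) isOpen_univ
      contDiffOn_const (by trivial)]
    have e : pd (fun _ : Fin n → ℝ => (1 : ℝ)) i = fun _ => 0 := by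
      ext
      simp [pd]
    rw [e]
    simp [pd]
  simp only [ξ_t, ξ_i, ξ_ij, S_eq, D_eq, A_t z hz, A_i z hz, A_ij z hz, mul_zero, add_zero,
    Finset.sum_const_zero, sub_zero]
  set x : Fin n → ℝ := fun k => z (some k) with hx
  have hdiv := h.divergence_lowered hxU
  have r1 : ∑ i, ∑ j, (g x)⁻¹ i j * (lowered g Y i x * p (some j)) = ∑ i, Y i x * p (some i) := by
    rw [Finset.sum_comm]
    refine Finset.sum_congr rfl fun j _ => ?_
    rw [← h.raise_lowered' hxU j, Finset.sum_mul]
    exact Finset.sum_congr rfl fun i _ => by ring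
  have r2 : ∑ i, ∑ j, (g x)⁻¹ i j * (lowered g Y j x * p (some i)) = ∑ i, Y i x * p (some i) := by
    refine Finset.sum_congr rfl fun j _ => ?_
    rw [← h.raise_lowered hxU j, Finset.sum_mul]
    exact Finset.sum_congr rfl fun i _ => by ring
  have s1 : ∑ i, ∑ j, (g x)⁻¹ i j * (-(1 / 2) * deriv T (z none) * pd (lowered g Y i) j x * u
        + -(1 / 2) * deriv T (z none) * lowered g Y i x * p (some j)
        + -(1 / 2) * deriv T (z none) * lowered g Y j x * p (some i)
        + A z * q (some i) (some j))
      = -(1 / 2) * deriv T (z none) * u * (∑ i, ∑ j, (g x)⁻¹ i j * pd (lowered g Y i) j x)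
        - deriv T (z none) * (∑ i, Y i x * p (some i))
        + A z * ∑ i, ∑ j, (g x)⁻¹ i j * q (some i) (some j) := by
    have : -(deriv T (z none) * (∑ i, Y i x * p (some i)))
        = -(1 / 2) * deriv T (z none) * ∑ i, ∑ j, (g x)⁻¹ i j * (lowered g Y i x * p (some j))
        + -(1 / 2) * deriv T (z none) * ∑ i, ∑ j, (g x)⁻¹ i j * (lowered g Y j x * p (some i)) := by
      rw [r1, r2]
      ring
    rw [sub_eq_add_neg, this]
    simp only [Finset.mul_sum, ← Finset.sum_add_distrib]
    exact Finset.sum_congr rfl fun i _ => Finset.sum_congr rfl fun j _ => by ring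
  have s2 : ∑ i, christoffelTrace g i x
        * (-(1 / 2) * deriv T (z none) * lowered g Y i x * u + A z * p (some i))
      = -(1 / 2) * deriv T (z none) * u * ∑ i, christoffelTrace g i x * lowered g Y i x
        + A z * ∑ i, christoffelTrace g i x * p (some i) := by
    simp only [Finset.mul_sum, ← Finset.sum_add_distrib]
    exact Finset.sum_congr rfl fun i _ => by ring
  have hWx : W x = ∑ k, Y k x * pd V k x + 2 * ψ * V x := rfl
  rw [s1, s2, schrodinger]
  simp only [← hx]
  linear_combination (-(1 / 2) * deriv T (z none) * u) * hdiv + T (z none) * u * hWx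

end IsHomotheticOn

end Schrodinger

section Schrodinger

variable {n : ℕ}

variable {g : (Fin n → ℝ) → Matrix (Fin n) (Fin n) ℝ} {Y : Fin n → (Fin n → ℝ) → ℝ} {ψ : ℝ}
  {U : Set (Fin n → ℝ)} {V : (Fin n → ℝ) → ℝ} {T : ℝ → ℝ}
  {ξ η : (Option (Fin n) → ℝ) × ℝ → ℝ}

/-! ### The determining equations of Lie point symmetries -/

/-- The symmetric second derivatives with `u_{,tt} = 0`, `u_{,ti} = v i` and `u_{,ij} = Q i j`. -/
def secondDerivs (v : Fin n → ℝ) (Q : Fin n → Fin n → ℝ) (a b : Option (Fin n)) : ℝ :=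
  a.elim (b.elim 0 v) fun i => b.elim (v i) (Q i)

theorem secondDerivs_symm (v : Fin n → ℝ) {Q : Fin n → Fin n → ℝ} (hQ : ∀ i j, Q i j = Q j i)
    (a b : Option (Fin n)) : secondDerivs v Q a b = secondDerivs v Q b a := by
  cases a <;> cases b <;> simp [secondDerivs]
  exact hQ _ _

namespace IsHomotheticOn

/-- The value of `u_{,t}` on the solutions of the Schrödinger equation. -/
def solvedTimeDeriv (g : (Fin n → ℝ) → Matrix (Fin n) (Fin n) ℝ) (V : (Fin n → ℝ) → ℝ)
    (x : Fin n → ℝ) (u : ℝ) (p : Fin n → ℝ) (Q : Fin n → Fin n → ℝ) : ℝ :=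
  ∑ i, ∑ j, (g x)⁻¹ i j * Q i j - ∑ i, christoffelTrace g i x * p i - V x * u

/-- Taking `u_{,t}` from the equation makes `H = 0`, so the unknown multiplier plays no role. The
variables `u`, `u_{,i}`, `u_{,ti}` and symmetric `u_{,ij}` remain free for comparing coefficients.
-/
theorem prolong2_eq_zero
    (hL : IsLiePointSymmetryOn (schrodinger g V) (cylinder U) (liftedField ξ T Y) η)
    {z : Option (Fin n) → ℝ} (hz : z ∈ cylinder U) (u : ℝ) (p v : Fin n → ℝ)
    {Q : Fin n → Fin n → ℝ} (hQ : ∀ i j, Q i j = Q j i) {x : Fin n → ℝ}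
    (hx : x = fun k => z (some k)) :
    prolong2 (liftedField ξ T Y) η (schrodinger g V)
      (z, u, fun a => a.elim (solvedTimeDeriv g V x u p Q) p, secondDerivs v Q) = 0 := by
  obtain ⟨-, -, μ, hμ⟩ := hL
  rw [hμ _ hz (secondDerivs_symm v hQ), mul_eq_zero]
  right
  simp only [schrodinger, ← hx, solvedTimeDeriv, secondDerivs, Option.elim]
  ring

theorem raise_mulVec (h : IsHomotheticOn g Y ψ U) {x : Fin n → ℝ} (hx : x ∈ U)
    (w : Fin n → ℝ) (i : Fin n) : ∑ j, (g x)⁻¹ i j * (g x).mulVec w j = w i := by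
  have e : ((g x)⁻¹).mulVec ((g x).mulVec w) i = w i := by
    rw [Matrix.mulVec_mulVec, Matrix.nonsing_inv_mul _ (h.isUnit_det x hx), Matrix.one_mulVec]
  exact e

/-- The derivatives `u_{,ti}` enter only through `-2 g^{ij} u_{,ti} D_j ξ`. Subtracting the
condition with `u_{,ti} = 0` from the one with `u_{,ti} = g_{ik} D_k ξ` leaves a multiple of `∑ (D_i
ξ)²`. This is a Euclidean sum of squares whatever the signature of `g`. -/
theorem totalDeriv0_time_component_eq_zero (h : IsHomotheticOn g Y ψ U)
    (hV : ContDiffOn ℝ ∞ V U) (hT : ContDiff ℝ ∞ T)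
    (hL : IsLiePointSymmetryOn (schrodinger g V) (cylinder U) (liftedField ξ T Y) η)
    {z : Option (Fin n) → ℝ} (hz : z ∈ cylinder U) (u : ℝ) (p : Option (Fin n) → ℝ)
    (i : Fin n) : totalDeriv0 ξ (some i) (z, u, p) = 0 := by
  have hξ : ContDiffOn ℝ ∞ ξ (cylinder U ×ˢ Set.univ) := hL.1 none
  have hη := hL.2.1
  have hZ := isOpen_cylinder h.isOpen
  set x : Fin n → ℝ := fun k => z (some k) with hx
  have hxU : x ∈ U := hz
  set D : Fin n → ℝ := fun i => totalDeriv0 ξ (some i) (z, u, p) with hD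
  set p' : Option (Fin n) → ℝ := fun a =>
    a.elim (solvedTimeDeriv g V x u (fun i => p (some i)) 0) fun i => p (some i) with hp'
  have hDp : ∀ i, totalDeriv0 ξ (some i) (z, u, p') = D i := fun i => rfl
  have e0 := prolong2_eq_zero hL hz u (fun i => p (some i)) 0 (Q := 0) (fun _ _ => rfl) hx
  have e1 := prolong2_eq_zero hL hz u (fun i => p (some i)) ((g x).mulVec D) (Q := 0)
    (fun _ _ => rfl) hx
  rw [← hp', h.prolong2_schrodinger hV hT hξ hη hz _ _ _ hx] at e0 e1
  -- The spatial second total derivatives involve only the spatial block of `q`, on which the two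
  -- test jets agree.
  have hS : ∀ {F : (Option (Fin n) → ℝ) × ℝ → ℝ}, ContDiffOn ℝ ∞ F (cylinder U ×ˢ Set.univ) →
      ∀ i j, totalDeriv1 (totalDeriv0 F (some i)) (some j)
        (z, u, p', secondDerivs ((g x).mulVec D) 0)
      = totalDeriv1 (totalDeriv0 F (some i)) (some j) (z, u, p', secondDerivs 0 0) :=
    fun hF i j => by
      rw [totalDeriv1_totalDeriv0 hZ hF _ _ hz, totalDeriv1_totalDeriv0 hZ hF _ _ hz]
      rfl
  simp only [hDp, secondDerivs, Option.elim, mul_add, Finset.sum_add_distrib] at e0 e1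
  have e2 : ∑ i, ∑ j, (g x)⁻¹ i j * ((g x).mulVec D j * D i)
      + ∑ i, ∑ j, (g x)⁻¹ i j * ((g x).mulVec D i * D j) = 0 := by
    simp only [hS hξ, hS hη, Pi.zero_apply, mul_zero, Finset.sum_const_zero] at e1
    simp only [Pi.zero_apply, zero_mul, mul_zero, Finset.sum_const_zero] at e0
    linarith
  have e3 : ∑ i, ∑ j, (g x)⁻¹ i j * ((g x).mulVec D j * D i) = ∑ i, D i ^ 2 := by
    refine Finset.sum_congr rfl fun i _ => ?_
    have e : ∑ j, (g x)⁻¹ i j * ((g x).mulVec D j * D i)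
        = D i * ∑ j, (g x)⁻¹ i j * (g x).mulVec D j := by
      rw [Finset.mul_sum]
      exact Finset.sum_congr rfl fun j _ => by ring
    rw [e, h.raise_mulVec hxU D i]
    ring
  have e4 : ∑ i, ∑ j, (g x)⁻¹ i j * ((g x).mulVec D i * D j)
      = ∑ i, ∑ j, (g x)⁻¹ i j * ((g x).mulVec D j * D i) := by
    rw [Finset.sum_comm]
    exact Finset.sum_congr rfl fun j _ => Finset.sum_congr rfl fun k _ => by
      rw [(h.inv_isSymm hxU).apply j k]
  rw [e4, e3] at e2
  have e5 : ∑ i, D i ^ 2 = 0 := by linarith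
  have := (Finset.sum_eq_zero_iff_of_nonneg fun i _ => sq_nonneg (D i)).1 e5 i (Finset.mem_univ i)
  exact pow_eq_zero_iff two_ne_zero |>.1 this

/-- The equations for `η` that a Lie point symmetry satisfies. -/
theorem determining_equations (h : IsHomotheticOn g Y ψ U)
    (hV : ContDiffOn ℝ ∞ V U) (hT : ContDiff ℝ ∞ T)
    (hL : IsLiePointSymmetryOn (schrodinger g V) (cylinder U) (liftedField ξ T Y) η)
    {z : Option (Fin n) → ℝ} (hz : z ∈ cylinder U) (u : ℝ) {x : Fin n → ℝ}
    (hx : x = fun k => z (some k)) (i₀ : Fin n) :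
    fderiv ℝ (fderiv ℝ η) (z, u) (0, 1) (0, 1) = 0 ∧
    (∀ i, fderiv ℝ (fderiv ℝ η) (z, u) (Pi.single (some i) 1, 0) (0, 1)
      = -(1 / 2) * deriv T (z none) * lowered g Y i x) ∧
    ∑ i, ∑ j, (g x)⁻¹ i j * fderiv ℝ (fderiv ℝ η) (z, u) (Pi.single (some j) 1, 0)
        (Pi.single (some i) 1, 0)
      - ∑ i, christoffelTrace g i x * fderiv ℝ η (z, u) (Pi.single (some i) 1, 0)
      - fderiv ℝ η (z, u) (Pi.single none 1, 0)
      + V x * u * fderiv ℝ η (z, u) (0, 1) - V x * η (z, u)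
      - T (z none) * potentialVariation Y ψ V x * u = 0 := by
  have hξ : ContDiffOn ℝ ∞ ξ (cylinder U ×ˢ Set.univ) := hL.1 none
  have hη := hL.2.1
  have hZ := isOpen_cylinder h.isOpen
  have hxU : x ∈ U := hx ▸ hz
  have hD : ∀ z ∈ cylinder U, ∀ u p i, totalDeriv0 ξ (some i) (z, u, p) = 0 := fun z hz u p i =>
    h.totalDeriv0_time_component_eq_zero hV hT hL hz u p i
  have hS : ∀ i j p q, totalDeriv1 (totalDeriv0 ξ (some i)) (some j) (z, u, p, q) = 0 :=
    fun i j p q => by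
      rw [totalDeriv1, fderiv_congr_of_eqOn (G := fun _ => (0 : ℝ)) (w := (z, u, p))
        (hZ.preimage continuous_fst) (fun y hy => hD y.1 hy y.2.1 y.2.2 i) hz]
      simp
  have split : ∀ (a : Option (Fin n)) (s : ℝ), ((Pi.single a 1, s) : (Option (Fin n) → ℝ) × ℝ)
      = (Pi.single a 1, 0) + s • (0, 1) := fun a s => by simp
  -- `D_i ξ = ξ_{,i} + p_i ξ_{,u}` vanishes for `p_i = 0` and for `p_i = 1`. A spatial index is
  -- needed here.
  have ξ_u : fderiv ℝ ξ (z, u) (0, 1) = 0 := by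
    have a0 := hD z hz u (fun _ => 0) i₀
    have a1 := hD z hz u (fun _ => 1) i₀
    simp only [totalDeriv0] at a0 a1
    rw [split _ 1, map_add, a0] at a1
    simpa using a1
  set ξt := fderiv ℝ ξ (z, u) (Pi.single none 1, 0) with hξt
  set B := fderiv ℝ (fderiv ℝ η) (z, u) with hB
  set b := fderiv ℝ η (z, u) with hb
  have hBs : ∀ v w, B v w = B w v := fun v w =>
    fderiv_fderiv_symm (hZ.prod isOpen_univ) hη (w := (z, u)) ⟨hz, trivial⟩ w v
  set r := B (0, 1) (0, 1) with hr
  set m : Fin n → ℝ := fun i => B (Pi.single (some i) 1, 0) (0, 1) with hm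
  set N : Fin n → Fin n → ℝ := fun i j =>
    B (Pi.single (some j) 1, 0) (Pi.single (some i) 1, 0) with hN
  set bi : Fin n → ℝ := fun i => b (Pi.single (some i) 1, 0) with hbi
  have hBp : ∀ i j s t, B (Pi.single (some j) 1, s) (Pi.single (some i) 1, t)
      = N i j + t * m j + s * m i + s * t * r := fun i j s t => by
    rw [split _ s, split _ t]
    simp only [map_add, map_smul, _root_.add_apply, _root_.smul_apply, smul_eq_mul]
    rw [hBs (0, 1) (Pi.single (some i) 1, 0)]
    ring
  have hbp : ∀ a s, b (Pi.single a 1, s) = b (Pi.single a 1, 0) + s * b (0, 1) := fun a s => by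
    rw [split _ s, map_add, map_smul, smul_eq_mul]
  have hξp : ∀ s, fderiv ℝ ξ (z, u) (Pi.single none 1, s) = ξt := fun s => by
    rw [split _ s, map_add, map_smul, ξ_u, smul_zero, add_zero]
  set C : ℝ := ∑ i, ∑ j, (g x)⁻¹ i j * N i j - ∑ i, christoffelTrace g i x * bi i
      - b (Pi.single none 1, 0) + V x * u * b (0, 1) - V x * η (z, u)
      - T (z none) * (∑ i, Y i x * pd V i x) * u - V x * u * ξt with hC
  set Γ : (Fin n → ℝ) → ℝ := fun p => ∑ i, christoffelTrace g i x * p i with hΓ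
  -- The test jets have `u_{,ti} = 0` and `u_{,ij} = κ g_{ij}`, so the trace `g^{ij} u_{,ij} = κ n`
  -- is a free scalar. The result is a polynomial in `κ` and `p`, whose coefficients are the
  -- determining equations.
  have eq : ∀ (κ : ℝ) (p : Fin n → ℝ),
      C + 2 * ∑ i, (∑ j, (g x)⁻¹ i j * m j) * p i + deriv T (z none) * ∑ i, Y i x * p i
        + r * ∑ i, ∑ j, (g x)⁻¹ i j * p i * p j
        + (κ * n - Γ p) * (ξt - 2 * ψ * T (z none)) = 0 := fun κ p => by
    have e := prolong2_eq_zero hL hz u p 0 (Q := fun i j => κ * g x i j)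
      (fun i j => by rw [(h.isSymm x hxU).apply j i]) hx
    rw [h.prolong2_schrodinger hV hT hξ hη hz _ _ _ hx] at e
    simp only [hD z hz, hS, totalDeriv1_totalDeriv0 hZ hη _ _
      (J := (z, u, _, _)) hz] at e
    simp only [totalDeriv0, Option.elim, secondDerivs, ← hB, ← hb, hBp, hξp] at e
    simp only [hbp _ (p _), hbp _ (solvedTimeDeriv _ _ _ _ _ _)] at e
    have tr : ∑ i, ∑ j, (g x)⁻¹ i j * (κ * g x i j) = κ * n := by
      have e1 : ((g x)⁻¹ * g x).trace = n := by
        rw [Matrix.nonsing_inv_mul _ (h.isUnit_det x hxU)]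
        simp
      rw [← e1]
      simp only [Matrix.trace, Matrix.diag_apply, Matrix.mul_apply, Finset.mul_sum]
      exact Finset.sum_congr rfl fun i _ => Finset.sum_congr rfl fun j _ => by
        rw [(h.isSymm x hxU).apply i j]
        ring
    have s1 : ∑ i, ∑ j, (g x)⁻¹ i j * (N i j + p i * m j + p j * m i + p j * p i * r
          + κ * g x i j * b (0, 1))
        = ∑ i, ∑ j, (g x)⁻¹ i j * N i j + 2 * ∑ i, (∑ j, (g x)⁻¹ i j * m j) * p i
          + r * ∑ i, ∑ j, (g x)⁻¹ i j * p i * p j + κ * n * b (0, 1) := by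
      have s3 : ∑ i, ∑ j, (g x)⁻¹ i j * (p j * m i) = ∑ i, (∑ j, (g x)⁻¹ i j * m j) * p i := by
        rw [Finset.sum_comm]
        simp only [Finset.sum_mul]
        exact Finset.sum_congr rfl fun i _ => Finset.sum_congr rfl fun j _ => by
          rw [(h.inv_isSymm hxU).apply i j]
          ring
      have s4 : 2 * ∑ i, (∑ j, (g x)⁻¹ i j * m j) * p i
          = ∑ i, (∑ j, (g x)⁻¹ i j * m j) * p i + ∑ i, ∑ j, (g x)⁻¹ i j * (p j * m i) := by
        rw [s3]
        ring
      rw [s4, ← tr]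
      simp only [Finset.mul_sum, Finset.sum_mul, ← Finset.sum_add_distrib]
      exact Finset.sum_congr rfl fun i _ => Finset.sum_congr rfl fun j _ => by ring
    have s2 : ∑ i, christoffelTrace g i x * (b (Pi.single (some i) 1, 0) + p i * b (0, 1))
        = ∑ i, christoffelTrace g i x * bi i + Γ p * b (0, 1) := by
      simp only [hΓ, Finset.sum_mul, ← Finset.sum_add_distrib]
      exact Finset.sum_congr rfl fun i _ => by ring
    rw [s1, s2, solvedTimeDeriv, tr] at e
    simp only [Pi.zero_apply, mul_zero, add_zero, Finset.sum_const_zero, sub_zero] at e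
    linear_combination e
  have hn : (n : ℝ) ≠ 0 := by
    have : n ≠ 0 := fun h0 => (h0 ▸ i₀).elim0
    exact_mod_cast this
  -- The coefficient of `κ`; dividing by `n` is allowed because `i₀` exists.
  have hξψ : ξt = 2 * ψ * T (z none) := by
    have a0 := eq 0 0
    have a1 := eq 1 0
    have : (n : ℝ) * (ξt - 2 * ψ * T (z none)) = 0 := by linear_combination a1 - a0
    linarith [(mul_eq_zero.1 this).resolve_left hn]
  have hC0 : C = 0 := by
    have a0 := eq 0 0
    simpa [hξψ, hΓ] using a0
  have eq' : ∀ p : Fin n → ℝ, 2 * ∑ i, (∑ j, (g x)⁻¹ i j * m j) * p i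
      + deriv T (z none) * ∑ i, Y i x * p i + r * ∑ i, ∑ j, (g x)⁻¹ i j * p i * p j = 0 :=
    fun p => by
      have := eq 0 p
      rw [hC0, hξψ] at this
      linarith
  -- Replacing `p` by `-p` separates the linear part, which determines `m`, from the quadratic part,
  -- which forces `r = 0`.
  have eqn : ∀ p : Fin n → ℝ, -(2 * ∑ i, (∑ j, (g x)⁻¹ i j * m j) * p i)
      - deriv T (z none) * ∑ i, Y i x * p i + r * ∑ i, ∑ j, (g x)⁻¹ i j * p i * p j = 0 :=
    fun p => by
      have := eq' (-p)
      simp only [Pi.neg_apply, mul_neg, neg_mul, neg_neg, Finset.sum_neg_distrib] at this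
      linarith
  have hr0 : r = 0 := by
    obtain ⟨p, hp⟩ := exists_quadratic_ne_zero (g x)⁻¹ (h.inv_isSymm hxU)
      (Matrix.isUnit_nonsing_inv_det _ (h.isUnit_det x hxU)) i₀
    have : r * ∑ i, ∑ j, (g x)⁻¹ i j * p i * p j = 0 := by
      linear_combination (1 / 2) * eq' p + (1 / 2) * eqn p
    exact (mul_eq_zero.1 this).resolve_right hp
  have hm0 : ∀ i, m i = -(1 / 2) * deriv T (z none) * lowered g Y i x := by
    have a : ((g x)⁻¹).mulVec m = (-(1 / 2) * deriv T (z none)) • fun i => Y i x := by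
      ext i
      have := eq' (Pi.single i 1)
      rw [hr0, zero_mul, add_zero] at this
      simp only [Pi.single_apply, mul_ite, mul_one, mul_zero, Finset.sum_ite_eq',
        Finset.mem_univ, if_true] at this
      simp only [Matrix.mulVec, dotProduct, Pi.smul_apply, smul_eq_mul]
      linarith
    have c : m = (g x).mulVec (((g x)⁻¹).mulVec m) := by
      rw [Matrix.mulVec_mulVec, Matrix.mul_nonsing_inv _ (h.isUnit_det x hxU), Matrix.one_mulVec]
    intro i
    rw [c, a, Matrix.mulVec_smul]
    rfl
  refine ⟨hr0, hm0, ?_⟩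
  rw [hC, hξψ] at hC0
  rw [potentialVariation]
  linear_combination hC0

/-- A Lie point symmetry `ξ ∂_t + T(t) Yⁱ ∂_i + η ∂_u` relates `Y` to the variation of `V`. -/
theorem lie_compatibility (h : IsHomotheticOn g Y ψ U)
    (hV : ContDiffOn ℝ ∞ V U) (hT : ContDiff ℝ ∞ T)
    (hL : IsLiePointSymmetryOn (schrodinger g V) (cylinder U) (liftedField ξ T Y) η)
    (t : ℝ) {x : Fin n → ℝ} (hx : x ∈ U) (i : Fin n) :
    2 * T t * pd (potentialVariation Y ψ V) i x = deriv (deriv T) t * lowered g Y i x := by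
  have hη := hL.2.1
  have hZ := isOpen_cylinder h.isOpen
  have hO := hZ.prod (isOpen_univ (X := ℝ))
  have de := fun z (hz : z ∈ cylinder U) u =>
    h.determining_equations hV hT hL hz u (x := fun k => z (some k)) rfl i
  set A : (Option (Fin n) → ℝ) → ℝ := fun z => fderiv ℝ η (z, 0) (0, 1) with hA
  have hA_smooth : ContDiffOn ℝ ∞ A (cylinder U) :=
    (fderiv_apply_contDiffOn hO hη (0, 1)).comp
      (contDiff_id.prodMk contDiff_const).contDiffOn fun z hz => ⟨hz, trivial⟩
  have hu : ∀ z ∈ cylinder U, ∀ u, fderiv ℝ η (z, u) (0, 1) = A z := fun z hz u => by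
    have hd : ∀ u, HasDerivAt (fun u => fderiv ℝ η (z, u) (0, 1)) 0 u := fun u => by
      have := hasDerivAt_fiber hZ (fderiv_apply_contDiffOn hO hη (0, 1)) hz u
      rwa [fderiv_fderiv_apply hO hη (w := (z, u)) ⟨hz, trivial⟩, (de z hz u).1] at this
    exact is_const_of_deriv_eq_zero (fun u => (hd u).differentiableAt) (fun u => (hd u).deriv) u 0
  -- Since `η` is affine in `u`, its slope is the difference of its values at `u = 1` and `u = 0`.
  -- Subtracting the equations at these two heights removes the inhomogeneous part `η(z, 0)`.
  have hA1 : ∀ z ∈ cylinder U, A z = η (z, 1) - η (z, 0) := fun z hz => by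
    have hd : ∀ u, HasDerivAt (fun u => η (z, u) - u * A z) 0 u := fun u => by
      have := (hasDerivAt_fiber hZ hη hz u).fun_sub ((hasDerivAt_id u).mul_const (A z))
      rw [hu z hz u] at this
      simpa using this
    have := is_const_of_deriv_eq_zero (fun u => (hd u).differentiableAt)
      (fun u => (hd u).deriv) 1 0
    simp only [one_mul, zero_mul, sub_zero] at this
    linarith
  have slice_diff : ∀ {F : (Option (Fin n) → ℝ) × ℝ → ℝ},
      ContDiffOn ℝ ∞ F (cylinder U ×ˢ Set.univ) → ∀ {G : (Option (Fin n) → ℝ) → ℝ},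
      (∀ z ∈ cylinder U, G z = F (z, 1) - F (z, 0)) → ∀ z ∈ cylinder U, ∀ d,
      fderiv ℝ G z d = fderiv ℝ F (z, 1) (d, 0) - fderiv ℝ F (z, 0) (d, 0) :=
    fun {F} hF {G} hG z hz d => by
      have hs : ∀ u, DifferentiableAt ℝ (fun z => F (z, u)) z := fun u =>
        (differentiableAt_of_contDiffOn hO hF (w := (z, u)) ⟨hz, trivial⟩).comp z
          (differentiableAt_id.prodMk (differentiableAt_const u))
      rw [fderiv_congr_of_eqOn hZ hG hz, fderiv_fun_sub (hs 1) (hs 0), _root_.sub_apply,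
        fderiv_slice hZ hF hz, fderiv_slice hZ hF hz]
  have A_d : ∀ z ∈ cylinder U, ∀ d,
      fderiv ℝ A z d = fderiv ℝ η (z, 1) (d, 0) - fderiv ℝ η (z, 0) (d, 0) :=
    fun z hz d => slice_diff hη hA1 z hz d
  have A_i : ∀ z ∈ cylinder U, ∀ i, fderiv ℝ A z (Pi.single (some i) 1)
      = -(1 / 2) * deriv T (z none) * lowered g Y i fun k => z (some k) := fun z hz i => by
    rw [← (de z hz 0).2.1 i, ← fderiv_fderiv_apply hO hη (w := (z, 0)) ⟨hz, trivial⟩]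
    exact fderiv_slice hZ (fderiv_apply_contDiffOn hO hη (0, 1)) hz 0 _
  have dL := fun i x (hx : x ∈ U) => differentiableAt_of_contDiffOn h.isOpen
    (h.smooth_lowered i) hx
  have dT : Differentiable ℝ T := hT.differentiable (by simp)
  have hT2 := (contDiff_infty_iff_deriv.1 hT).2
  have dT2 : Differentiable ℝ (deriv T) := hT2.differentiable (by simp)
  have A_ij : ∀ z ∈ cylinder U, ∀ i j,
      fderiv ℝ (fderiv ℝ η) (z, 1) (Pi.single (some j) 1, 0) (Pi.single (some i) 1, 0)
        - fderiv ℝ (fderiv ℝ η) (z, 0) (Pi.single (some j) 1, 0) (Pi.single (some i) 1, 0)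
      = -(1 / 2) * deriv T (z none) * pd (lowered g Y i) j fun k => z (some k) :=
    fun z hz i j => by
      rw [← fderiv_fderiv_apply hO hη (w := (z, 1)) ⟨hz, trivial⟩,
        ← fderiv_fderiv_apply hO hη (w := (z, 0)) ⟨hz, trivial⟩,
        ← slice_diff (fderiv_apply_contDiffOn hO hη (Pi.single (some i) 1, 0))
          (G := fun z => fderiv ℝ A z (Pi.single (some i) 1)) (fun z hz => A_d z hz _) z hz,
        fderiv_congr_of_eqOn hZ (fun z hz => A_i z hz i) hz,
        fderiv_separated (some j) (S := fun t => -(1 / 2) * deriv T t) ((dT2 _).const_mul _)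
          (dL i _ hz)]
      rfl
  set W := potentialVariation Y ψ V with hW
  -- The third determining equation at `u = 1` minus the same at `u = 0` reads `A_t = ΔA - T W`, the
  -- terms in `V` cancelling. By `A_i = -½ T' Y_i` and the constant divergence, `ΔA = -½ nψ T'`.
  have A_t : ∀ z ∈ cylinder U, fderiv ℝ A z (Pi.single none 1)
      = -(1 / 2) * (n * ψ) * deriv T (z none) + -T (z none) * W fun k => z (some k) :=
    fun z hz => by
      have c1 := (de z hz 1).2.2
      have c0 := (de z hz 0).2.2
      set x : Fin n → ℝ := fun k => z (some k) with hx
      have hdiv := h.divergence_lowered (x := x) hz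
      rw [hu z hz] at c1 c0
      have s1 : ∑ i, ∑ j, (g x)⁻¹ i j * fderiv ℝ (fderiv ℝ η) (z, 1)
            (Pi.single (some j) 1, 0) (Pi.single (some i) 1, 0)
          - ∑ i, ∑ j, (g x)⁻¹ i j * fderiv ℝ (fderiv ℝ η) (z, 0)
            (Pi.single (some j) 1, 0) (Pi.single (some i) 1, 0)
          = -(1 / 2) * deriv T (z none) * ∑ i, ∑ j, (g x)⁻¹ i j * pd (lowered g Y i) j x := by
        simp only [← Finset.sum_sub_distrib, Finset.mul_sum, ← mul_sub, A_ij z hz]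
        exact Finset.sum_congr rfl fun i _ => Finset.sum_congr rfl fun j _ => by ring
      have s2 : ∑ i, christoffelTrace g i x * fderiv ℝ η (z, 1) (Pi.single (some i) 1, 0)
          - ∑ i, christoffelTrace g i x * fderiv ℝ η (z, 0) (Pi.single (some i) 1, 0)
          = -(1 / 2) * deriv T (z none) * ∑ i, christoffelTrace g i x * lowered g Y i x := by
        simp only [← Finset.sum_sub_distrib, Finset.mul_sum, ← mul_sub, ← A_d z hz, A_i z hz]
        exact Finset.sum_congr rfl fun i _ => by ring
      have s3 := A_d z hz (Pi.single none 1)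
      have s4 := hA1 z hz
      linear_combination s3 - c1 + c0 + s1 - s2 - (1 / 2) * deriv T (z none) * hdiv + V x * s4
  set z : Option (Fin n) → ℝ := fun a => a.elim t x with hz
  have hzU : z ∈ cylinder U := hx
  have hWs : ContDiffOn ℝ ∞ W U := h.smooth_potentialVariation hV
  -- Integrability of `A` in `t` and `xⁱ`: `-T ∂_i W = -½ T'' Y_i`.
  have key := fderiv_comm_of_eqOn hZ hA_smooth (fun z hz => A_t z hz)
    (fun z hz => A_i z hz i) hzU
  rw [fderiv_separated none (S := fun t => -(1 / 2) * deriv T t) ((dT2 _).const_mul _)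
    (dL i x hx)] at key
  have e1 := fderiv_separated (some i) (S := fun t => -(1 / 2) * (n * ψ) * deriv T t)
    (F := fun _ => (1 : ℝ)) (z := z) ((dT2 _).const_mul _) (differentiableAt_const _)
  have e2 := fderiv_separated (some i) (S := fun t => -T t) (F := W) (z := z) (dT _).neg
    (differentiableAt_of_contDiffOn h.isOpen hWs hx)
  have f1 : DifferentiableAt ℝ (fun z : Option (Fin n) → ℝ =>
      -(1 / 2) * (n * ψ) * deriv T (z none)) z :=
    ((dT2 _).comp z (differentiableAt_apply none z)).const_mul _
  have f2 : DifferentiableAt ℝ (fun z : Option (Fin n) → ℝ =>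
      -T (z none) * W fun k => z (some k)) z :=
    (hasFDerivAt_separated (T := fun t => -T t) (ContinuousLinearMap.proj none) (spaceProj n)
      (dT _).neg (differentiableAt_of_contDiffOn h.isOpen hWs hx)).differentiableAt
  rw [fderiv_fun_add f1 f2, _root_.add_apply, e2] at key
  simp only [mul_one] at e1
  rw [e1] at key
  simp only [Option.elim, pd, fderiv_fun_const, deriv_const_mul_field] at key
  simp at key
  have key' : T t * pd W i x = 2⁻¹ * deriv (deriv T) t * lowered g Y i x := key
  linarith

end IsHomotheticOn

end Schrodinger

/-! ### Noether point symmetries -/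

section NoetherEquations

variable {n : ℕ}

variable {g : (Fin n → ℝ) → Matrix (Fin n) (Fin n) ℝ} {Y : Fin n → (Fin n → ℝ) → ℝ} {ψ : ℝ}
  {U : Set (Fin n → ℝ)} {V : (Fin n → ℝ) → ℝ} {T : ℝ → ℝ}
  {τ f : ℝ × (Fin n → ℝ) → ℝ}

theorem fderiv_separated_prod {S : ℝ → ℝ} {F : (Fin n → ℝ) → ℝ} {t : ℝ} {x : Fin n → ℝ}
    (hS : DifferentiableAt ℝ S t) (hF : DifferentiableAt ℝ F x) (s : ℝ) (v : Fin n → ℝ) :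
    fderiv ℝ (fun w : ℝ × (Fin n → ℝ) => S w.1 * F w.2) (t, x) (s, v)
      = S t * ∑ k, v k * pd F k x + F x * deriv S t * s := by
  have h := hasFDerivAt_separated (w := (t, x)) (ContinuousLinearMap.fst ℝ ℝ (Fin n → ℝ))
    (ContinuousLinearMap.snd ℝ ℝ (Fin n → ℝ)) hS hF
  rw [← fderiv_eq_sum_pd]
  exact congrArg (fun φ => φ (s, v)) h.fderiv

namespace IsHomotheticOn

theorem fderiv_lagrangian (h : IsHomotheticOn g Y ψ U) (hV : ContDiffOn ℝ ∞ V U) {t : ℝ}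
    {x : Fin n → ℝ} (hx : x ∈ U) (v : Fin n → ℝ) (d : ℝ × (Fin n → ℝ) × (Fin n → ℝ)) :
    fderiv ℝ (lagrangian g V) (t, x, v) d
      = (1 / 2) * (∑ i, ∑ j, fderiv ℝ (fun y => g y i j) x d.2.1 * v i * v j)
        + ∑ i, ∑ j, g x i j * d.2.2 i * v j - fderiv ℝ V x d.2.1 := by
  have hp : ∀ i, HasFDerivAt (fun w : ℝ × (Fin n → ℝ) × (Fin n → ℝ) => w.2.2 i)
      ((ContinuousLinearMap.proj (R := ℝ) (φ := fun _ : Fin n => ℝ) i).comp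
        ((ContinuousLinearMap.snd ℝ _ _).comp
          (ContinuousLinearMap.snd ℝ ℝ ((Fin n → ℝ) × (Fin n → ℝ))))) (t, x, v) := fun i =>
    by apply hasFDerivAt_of_eq_clm; exact fun _ => rfl
  have hm : HasFDerivAt (fun w : ℝ × (Fin n → ℝ) × (Fin n → ℝ) => w.2.1)
      ((ContinuousLinearMap.fst ℝ _ _).comp
        (ContinuousLinearMap.snd ℝ ℝ ((Fin n → ℝ) × (Fin n → ℝ)))) (t, x, v) :=
    by apply hasFDerivAt_of_eq_clm; exact fun _ => rfl
  have hc : ∀ {F : (Fin n → ℝ) → ℝ}, ContDiffOn ℝ ∞ F U →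
      HasFDerivAt (fun w : ℝ × (Fin n → ℝ) × (Fin n → ℝ) => F w.2.1)
        ((fderiv ℝ F x).comp ((ContinuousLinearMap.fst ℝ _ _).comp
          (ContinuousLinearMap.snd ℝ ℝ ((Fin n → ℝ) × (Fin n → ℝ))))) (t, x, v) := fun hF =>
    (differentiableAt_of_contDiffOn h.isOpen hF hx).hasFDerivAt.comp (t, x, v) hm
  have e := ((HasFDerivAt.fun_sum (u := Finset.univ) fun i _ =>
    HasFDerivAt.fun_sum (u := Finset.univ) fun j _ =>
      ((hc (h.smooth_metric i j)).fun_mul (hp i)).fun_mul (hp j)).const_mul (1 / 2)).sub (hc hV)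
  refine (congrArg (fun φ => φ d) e.fderiv).trans ?_
  simp only [_root_.sub_apply, _root_.sum_apply, _root_.add_apply, _root_.smul_apply,
    ContinuousLinearMap.comp_apply, ContinuousLinearMap.coe_snd', ContinuousLinearMap.coe_fst',
    ContinuousLinearMap.proj_apply, smul_eq_mul]
  have e1 : ∑ i, ∑ j, g x i j * d.2.2 i * v j = (1 / 2) * ∑ i, ∑ j, g x i j * d.2.2 i * v j
      + (1 / 2) * ∑ i, ∑ j, g x i j * v i * d.2.2 j := by
    have e2 : ∑ i, ∑ j, g x i j * v i * d.2.2 j = ∑ i, ∑ j, g x i j * d.2.2 i * v j := by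
      rw [Finset.sum_comm]
      exact Finset.sum_congr rfl fun i _ => Finset.sum_congr rfl fun j _ => by
        rw [(h.isSymm x hx).apply i j]
        ring
    rw [e2]
    ring
  rw [e1]
  congr 1
  simp only [Finset.mul_sum, ← Finset.sum_add_distrib]
  exact Finset.sum_congr rfl fun i _ => Finset.sum_congr rfl fun j _ => by ring

theorem sum_eq_dotProduct (A : Matrix (Fin n) (Fin n) ℝ) (v w : Fin n → ℝ) :
    ∑ i, ∑ j, A i j * v i * w j = v ⬝ᵥ A.mulVec w := by
  simp only [dotProduct, Matrix.mulVec, Finset.mul_sum]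
  exact Finset.sum_congr rfl fun i _ => Finset.sum_congr rfl fun j _ => by ring

/-- The left-hand side of the Noether condition for `τ ∂_t + T(t) Yⁱ ∂_i`. -/
theorem noether_lhs (h : IsHomotheticOn g Y ψ U) (hV : ContDiffOn ℝ ∞ V U)
    (hT : ContDiff ℝ ∞ T) (t : ℝ) {x : Fin n → ℝ} (hx : x ∈ U) (v : Fin n → ℝ) :
    prolongLagrangian τ (fun i w => T w.1 * Y i w.2) (lagrangian g V) t x v
        + timeDeriv τ t x v * lagrangian g V (t, x, v)
      = (ψ * T t - (1 / 2) * timeDeriv τ t x v) * (∑ i, ∑ j, g x i j * v i * v j)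
        + deriv T t * (∑ i, v i * lowered g Y i x) - T t * (∑ i, Y i x * pd V i x)
        - timeDeriv τ t x v * V x := by
  have dT : Differentiable ℝ T := hT.differentiable (by simp)
  set θ := timeDeriv τ t x v with hθ
  have hd : ∀ i, timeDeriv (fun w => T w.1 * Y i w.2) t x v
      = T t * (jacobian Y x).mulVec v i + deriv T t * Y i x := fun i => by
    rw [timeDeriv, fderiv_separated_prod (dT t)
      (differentiableAt_of_contDiffOn h.isOpen (h.smooth_field i) hx)]
    simp only [Matrix.mulVec, dotProduct, jacobian, Matrix.of_apply, mul_one]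
    rw [mul_comm (Y i x)]
    congr 2
    exact Finset.sum_congr rfl fun k _ => mul_comm _ _
  have hY : (fun i => T t * Y i x) = T t • fun i => Y i x := rfl
  rw [prolongLagrangian, h.fderiv_lagrangian hV hx]
  simp only [hd, hY, map_smul, smul_eq_mul, fderiv_eq_sum_pd V, lagrangian]
  have e1 : ∑ i, ∑ j, T t * fderiv ℝ (fun y => g y i j) x (fun k => Y k x) * v i * v j
      = T t * (2 * ψ * ∑ i, ∑ j, g x i j * v i * v j
        - 2 * (v ⬝ᵥ (g x).mulVec ((jacobian Y x).mulVec v))) := by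
    have a : ∑ i, ∑ j, T t * fderiv ℝ (fun y => g y i j) x (fun k => Y k x) * v i * v j
        = T t * ∑ i, ∑ j, matrixDeriv g (fun k => Y k x) x i j * v i * v j := by
      simp only [Finset.mul_sum, matrixDeriv, Matrix.of_apply]
      exact Finset.sum_congr rfl fun i _ => Finset.sum_congr rfl fun j _ => by ring
    have b : v ⬝ᵥ ((jacobian Y x).transpose * g x).mulVec v
        = v ⬝ᵥ (g x).mulVec ((jacobian Y x).mulVec v) := by
      rw [← Matrix.mulVec_mulVec, Matrix.dotProduct_mulVec, Matrix.vecMul_transpose,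
        Matrix.dotProduct_mulVec, ← Matrix.mulVec_transpose, (h.isSymm x hx).eq,
        dotProduct_comm]
    rw [a, sum_eq_dotProduct, sum_eq_dotProduct, h.matrixDeriv_metric hx, Matrix.sub_mulVec,
      Matrix.sub_mulVec, dotProduct_sub, dotProduct_sub, b, ← Matrix.mulVec_mulVec,
      Matrix.smul_mulVec, dotProduct_smul, smul_eq_mul]
    ring
  -- The term `T v·gJv` from prolonging the velocities cancels the Jacobian part of the variation of
  -- the metric, so no derivative of `Y` remains in the Noether condition.
  have e2 : ∑ i, ∑ j, g x i j * (T t * (jacobian Y x).mulVec v i + deriv T t * Y i x - v i * θ)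
        * v j
      = T t * (v ⬝ᵥ (g x).mulVec ((jacobian Y x).mulVec v))
        + deriv T t * (∑ i, v i * lowered g Y i x) - θ * ∑ i, ∑ j, g x i j * v i * v j := by
    have a : ∀ w : Fin n → ℝ, ∑ i, ∑ j, g x i j * w i * v j = v ⬝ᵥ (g x).mulVec w := fun w => by
      rw [sum_eq_dotProduct, Matrix.dotProduct_mulVec, ← Matrix.mulVec_transpose,
        (h.isSymm x hx).eq, dotProduct_comm]
    have b : ∑ i, v i * lowered g Y i x = v ⬝ᵥ (g x).mulVec fun k => Y k x := rfl
    have c : (fun i => T t * (jacobian Y x).mulVec v i + deriv T t * Y i x - v i * θ)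
        = T t • (jacobian Y x).mulVec v + deriv T t • (fun i => Y i x) - θ • v := by
      ext i
      simp [mul_comm]
    rw [a fun i => T t * (jacobian Y x).mulVec v i + deriv T t * Y i x - v i * θ, c, b, a v]
    simp only [Matrix.mulVec_sub, Matrix.mulVec_add, Matrix.mulVec_smul, dotProduct_sub,
      dotProduct_add, dotProduct_smul, smul_eq_mul]
  have e3 : ∑ k, (T t • fun i => Y i x) k * pd V k x = T t * ∑ k, Y k x * pd V k x := by
    simp only [Pi.smul_apply, smul_eq_mul, mul_assoc, Finset.mul_sum]
  rw [e1, e2, e3]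
  ring

/-- The choice `τ_t = 2ψT` removes the terms quadratic in the velocity. The rest is the differential
of `f = αW`, since `f_t = α' W = -T W` and `f_i = cα Y_i = T' Y_i`. -/
theorem isNoetherPointSymmetryOn (h : IsHomotheticOn g Y ψ U) (hV : ContDiffOn ℝ ∞ V U)
    {c : ℝ} (hc : ∀ x ∈ U, ∀ i, pd (potentialVariation Y ψ V) i x = c * lowered g Y i x)
    {α : ℝ → ℝ} (hT : ContDiff ℝ ∞ T) (hα : ContDiff ℝ ∞ α) (hα' : ∀ t, deriv α t = -T t)
    (hT' : ∀ t, deriv T t = c * α t) :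
    IsNoetherPointSymmetryOn (lagrangian g V) U (fun w => -2 * ψ * α w.1)
      (fun i w => T w.1 * Y i w.2) (fun w => α w.1 * potentialVariation Y ψ V w.2) := by
  have hW := h.smooth_potentialVariation hV
  have sp : ∀ {F : (Fin n → ℝ) → ℝ}, ContDiffOn ℝ ∞ F U →
      ContDiffOn ℝ ∞ (fun w : ℝ × (Fin n → ℝ) => F w.2) (Set.univ ×ˢ U) :=
    fun hF => hF.comp contDiffOn_snd fun _ hw => hw.2
  have st : ∀ {S : ℝ → ℝ}, ContDiff ℝ ∞ S →
      ContDiffOn ℝ ∞ (fun w : ℝ × (Fin n → ℝ) => S w.1) (Set.univ ×ˢ U) :=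
    fun hS => (hS.comp contDiff_fst).contDiffOn
  refine ⟨contDiffOn_const.mul (st hα), fun i => (st hT).mul (sp (h.smooth_field i)),
    (st hα).mul (sp hW), fun t x v hx => ?_⟩
  have dα : Differentiable ℝ α := hα.differentiable (by simp)
  rw [h.noether_lhs hV hT t hx]
  have e1 : timeDeriv (fun w : ℝ × (Fin n → ℝ) => -2 * ψ * α w.1) t x v = 2 * ψ * T t := by
    have := fderiv_separated_prod (S := fun t => -2 * ψ * α t) (F := fun _ => (1 : ℝ)) (t := t)
      (x := x) ((dα t).const_mul _) (differentiableAt_const _) 1 v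
    simp only [mul_one] at this
    rw [timeDeriv, this]
    simp [pd, deriv_const_mul_field, hα']
  rw [e1, timeDeriv, fderiv_separated_prod (dα t)
    (differentiableAt_of_contDiffOn h.isOpen hW hx), hα', hT']
  have e2 : ∑ k, v k * pd (potentialVariation Y ψ V) k x
      = c * ∑ k, v k * lowered g Y k x := by
    rw [Finset.mul_sum]
    exact Finset.sum_congr rfl fun k _ => by
      rw [hc x hx]
      ring
  rw [e2, potentialVariation]
  ring

/-- A linear form vanishes if its product with a nonzero quadratic form does. -/
theorem linear_eq_zero_of_mul_quadratic (A : Matrix (Fin n) (Fin n) ℝ)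
    (ℓ : (Fin n → ℝ) →ₗ[ℝ] ℝ) {v₀ : Fin n → ℝ} (hv₀ : v₀ ⬝ᵥ A.mulVec v₀ ≠ 0)
    (hz : ∀ v, ℓ v * (v ⬝ᵥ A.mulVec v) = 0) (w : Fin n → ℝ) : ℓ w = 0 := by
  by_contra hw
  have h0 : ℓ v₀ = 0 := (mul_eq_zero.1 (hz v₀)).resolve_right hv₀
  -- On the line `v₀ + s w` the linear form equals `s ℓ(w)`, so for `s ≠ 0` the quadratic form must
  -- vanish there. Vanishing at `s = 1, -1, 2` kills a polynomial of degree two in `s`, including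
  -- its constant term at `v₀`.
  have hs : ∀ s : ℝ, s ≠ 0 → (v₀ ⬝ᵥ A.mulVec v₀)
      + s * (v₀ ⬝ᵥ A.mulVec w + w ⬝ᵥ A.mulVec v₀) + s ^ 2 * (w ⬝ᵥ A.mulVec w) = 0 :=
    fun s hs => by
      have h1 := hz (v₀ + s • w)
      rw [map_add, map_smul, h0, zero_add, smul_eq_mul] at h1
      have h2 := (mul_eq_zero.1 h1).resolve_left (mul_ne_zero hs hw)
      simp only [Matrix.mulVec_add, Matrix.mulVec_smul, dotProduct_add, add_dotProduct,
        dotProduct_smul, smul_dotProduct, smul_eq_mul] at h2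
      linear_combination h2
  have h1 := hs 1 one_ne_zero
  have h2 := hs (-1) (by norm_num)
  have h3 := hs 2 two_ne_zero
  exact hv₀ (by linarith)

/-- A Noether point symmetry `τ ∂_t + T(t) Yⁱ ∂_i` relates `Y` to the variation of `V`. -/
theorem noether_compatibility (h : IsHomotheticOn g Y ψ U) (hV : ContDiffOn ℝ ∞ V U)
    (hT : ContDiff ℝ ∞ T)
    (hN : IsNoetherPointSymmetryOn (lagrangian g V) U τ (fun i w => T w.1 * Y i w.2) f)
    (t : ℝ) {x : Fin n → ℝ} (hx : x ∈ U) (i : Fin n) :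
    T t * pd (potentialVariation Y ψ V) i x = -(deriv (deriv T) t) * lowered g Y i x := by
  obtain ⟨-, -, hf, hN⟩ := hN
  have hW := h.smooth_potentialVariation hV
  have hO : IsOpen ((Set.univ : Set ℝ) ×ˢ U) := isOpen_univ.prod h.isOpen
  have dT : Differentiable ℝ T := hT.differentiable (by simp)
  have dT2 : Differentiable ℝ (deriv T) :=
    ((contDiff_infty_iff_deriv.1 hT).2).differentiable (by simp)
  have key : ∀ w : ℝ × (Fin n → ℝ), w ∈ (Set.univ : Set ℝ) ×ˢ U →
      fderiv ℝ f w (1, 0) = -T w.1 * potentialVariation Y ψ V w.2 ∧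
      ∀ v, fderiv ℝ f w (0, v) = deriv T w.1 * ∑ i, v i * lowered g Y i w.2 := by
    rintro ⟨t, x⟩ ⟨-, hx⟩
    have hx : x ∈ U := hx
    have split : ∀ v : Fin n → ℝ, ((1, v) : ℝ × (Fin n → ℝ)) = (1, 0) + (0, v) := fun v => by simp
    have ht : ∀ (F : ℝ × (Fin n → ℝ) → ℝ) v,
        timeDeriv F t x v = fderiv ℝ F (t, x) (1, 0) + fderiv ℝ F (t, x) (0, v) := fun F v => by
      rw [timeDeriv, split, map_add]
    let ℓ : (Fin n → ℝ) →ₗ[ℝ] ℝ :=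
      (fderiv ℝ τ (t, x)).toLinearMap.comp (LinearMap.inr ℝ ℝ (Fin n → ℝ))
    let φ : (Fin n → ℝ) →ₗ[ℝ] ℝ :=
      (fderiv ℝ f (t, x)).toLinearMap.comp (LinearMap.inr ℝ ℝ (Fin n → ℝ))
    have hℓ : ∀ v, fderiv ℝ τ (t, x) (0, v) = ℓ v := fun v => rfl
    have hφ : ∀ v, fderiv ℝ f (t, x) (0, v) = φ v := fun v => rfl
    have hb : ∀ v : Fin n → ℝ, ∑ i, v i * lowered g Y i x = v ⬝ᵥ fun i => lowered g Y i x :=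
      fun v => rfl
    set τt := fderiv ℝ τ (t, x) (1, 0) with hτt
    set ft := fderiv ℝ f (t, x) (1, 0) with hft
    -- Replacing the velocity by `s • v` grades the Noether condition by degree. The cubic term
    -- carries the spatial derivative of `τ`, the quadratic one `τ_t`, the linear one `f_i` and the
    -- constant one `f_t`.
    have eq : ∀ (v : Fin n → ℝ) (s : ℝ),
        s ^ 3 * (-(1 / 2) * (ℓ v * (v ⬝ᵥ (g x).mulVec v)))
        + s ^ 2 * ((ψ * T t - (1 / 2) * τt) * (v ⬝ᵥ (g x).mulVec v))
        + s * (deriv T t * (v ⬝ᵥ fun i => lowered g Y i x) - ℓ v * V x - φ v)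
        + (-T t * (∑ i, Y i x * pd V i x) - τt * V x - ft) = 0 := fun v s => by
      have e := hN t x (s • v) hx
      rw [h.noether_lhs hV hT t hx, ht, ht, sum_eq_dotProduct, hℓ, hφ, hb, ← hτt, ← hft] at e
      simp only [map_smul, smul_eq_mul, Matrix.mulVec_smul, dotProduct_smul,
        smul_dotProduct] at e
      linear_combination e
    have coeff : ∀ a b c d : ℝ, (∀ s : ℝ, s ^ 3 * a + s ^ 2 * b + s * c + d = 0) →
        a = 0 ∧ b = 0 ∧ c = 0 ∧ d = 0 := fun a b c d hs => by
      have h0 := hs 0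
      have h1 := hs 1
      have h2 := hs (-1)
      have h3 := hs 2
      refine ⟨?_, ?_, ?_, ?_⟩ <;> linarith
    have eqs := fun v => coeff _ _ _ _ (eq v)
    obtain ⟨v₀, hv₀⟩ := exists_quadratic_ne_zero (g x) (h.isSymm x hx) (h.isUnit_det x hx) i
    rw [sum_eq_dotProduct] at hv₀
    have ℓ0 : ∀ v, ℓ v = 0 := linear_eq_zero_of_mul_quadratic (g x) ℓ hv₀ fun v => by
      linarith [(eqs v).1]
    have hτψ : τt = 2 * ψ * T t := by
      have := (mul_eq_zero.1 (eqs v₀).2.1).resolve_right hv₀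
      linarith
    refine ⟨?_, fun v => ?_⟩
    · have := (eqs 0).2.2.2
      rw [hτψ] at this
      rw [potentialVariation]
      linear_combination -this
    · have := (eqs v).2.2.1
      rw [ℓ0] at this
      rw [hφ, hb]
      linear_combination -this
  have hLi : ∀ w : ℝ × (Fin n → ℝ), w ∈ (Set.univ : Set ℝ) ×ˢ U →
      fderiv ℝ f w (0, Pi.single i 1) = deriv T w.1 * lowered g Y i w.2 := fun w hw => by
    rw [(key w hw).2]
    simp [Pi.single_apply]
  -- Integrability of `f` in `t` and `xⁱ`: `-T ∂_i W = T'' Y_i`.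
  have e := fderiv_comm_of_eqOn hO hf (fun w hw => (key w hw).1) hLi (w := (t, x)) ⟨trivial, hx⟩
  rw [fderiv_separated_prod (S := fun t => -T t) (dT t).neg
      (differentiableAt_of_contDiffOn h.isOpen hW hx),
    fderiv_separated_prod (dT2 t)
      (differentiableAt_of_contDiffOn h.isOpen (h.smooth_lowered i) hx)] at e
  simp [Pi.single_apply] at e
  linarith

end IsHomotheticOn

end NoetherEquations

/-! ### Linear oscillations -/

/-- The system is equivalent to `T'' = -kT` with a compatible primitive `α` of `-T`, solved by an
exponential, a constant or a cosine according to the sign of `k`. Carrying `α` along covers `k = 0`,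
where it cannot be recovered as `T' / k`. -/
theorem exists_oscillation (k : ℝ) : ∃ T α : ℝ → ℝ, ContDiff ℝ ∞ T ∧ ContDiff ℝ ∞ α ∧
    (∃ t, T t ≠ 0) ∧ (∀ t, deriv α t = -T t) ∧ ∀ t, deriv T t = k * α t := by
  rcases lt_trichotomy k 0 with hk | rfl | hk
  · obtain ⟨r, hr, rfl⟩ : ∃ r : ℝ, 0 < r ∧ k = -r ^ 2 :=
      ⟨Real.sqrt (-k), Real.sqrt_pos.2 (by linarith), by
        rw [Real.sq_sqrt (by linarith)]; ring⟩
    refine ⟨fun t => Real.exp (r * t), fun t => -(1 / r) * Real.exp (r * t), by fun_prop,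
      by fun_prop, ⟨0, by simp⟩, fun t => ?_, fun t => ?_⟩
    · have h : HasDerivAt (fun t : ℝ => -(1 / r) * Real.exp (r * t))
          (-(1 / r) * (Real.exp (r * t) * (r * 1))) t :=
        (((hasDerivAt_id t).const_mul r).exp).const_mul _
      rw [h.deriv]
      field_simp
    · have h : HasDerivAt (fun t : ℝ => Real.exp (r * t)) (Real.exp (r * t) * (r * 1)) t :=
        ((hasDerivAt_id t).const_mul r).exp
      rw [h.deriv]
      field_simp
  · refine ⟨fun _ => 1, fun t => -t, by fun_prop, by fun_prop, ⟨0, by simp⟩, fun t => ?_,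
      fun t => ?_⟩ <;> simp
  · obtain ⟨r, hr, rfl⟩ : ∃ r : ℝ, 0 < r ∧ k = r ^ 2 :=
      ⟨Real.sqrt k, Real.sqrt_pos.2 hk, by rw [Real.sq_sqrt hk.le]⟩
    refine ⟨fun t => Real.cos (r * t), fun t => -(1 / r) * Real.sin (r * t), by fun_prop,
      by fun_prop, ⟨0, by simp⟩, fun t => ?_, fun t => ?_⟩
    · have h : HasDerivAt (fun t : ℝ => -(1 / r) * Real.sin (r * t))
          (-(1 / r) * (Real.cos (r * t) * (r * 1))) t :=
        (((hasDerivAt_id t).const_mul r).sin).const_mul _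
      rw [h.deriv]
      field_simp
    · have h : HasDerivAt (fun t : ℝ => Real.cos (r * t)) (-Real.sin (r * t) * (r * 1)) t :=
        ((hasDerivAt_id t).const_mul r).cos
      rw [h.deriv]
      field_simp

/-! ### Locality of the symmetry conditions over an open set -/

section Congruence

variable {ι : Type} [Fintype ι] [DecidableEq ι]

theorem totalDeriv0_congr {F G : (ι → ℝ) × ℝ → ℝ} {U : Set (ι → ℝ)} (hU : IsOpen U)
    (h : ∀ w ∈ U ×ˢ (Set.univ : Set ℝ), F w = G w) (i : ι) {J : Jet1 ι} (hJ : J.1 ∈ U) :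
    totalDeriv0 F i J = totalDeriv0 G i J := by
  rw [totalDeriv0, fderiv_congr_of_eqOn (hU.prod isOpen_univ) h ⟨hJ, trivial⟩, totalDeriv0]

theorem prolong2_congr {ξ : ι → (ι → ℝ) × ℝ → ℝ} {η η' : (ι → ℝ) × ℝ → ℝ} {U : Set (ι → ℝ)}
    (hU : IsOpen U) (h : ∀ w ∈ U ×ˢ (Set.univ : Set ℝ), η w = η' w) (H : Jet2 ι → ℝ)
    {J : Jet2 ι} (hJ : J.1 ∈ U) : prolong2 ξ η H J = prolong2 ξ η' H J := by
  have h1 : ∀ i, ∀ J : Jet1 ι, J.1 ∈ U → prolongCoeff1 ξ η i J = prolongCoeff1 ξ η' i J :=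
    fun i J hJ => by rw [prolongCoeff1, totalDeriv0_congr hU h i hJ, prolongCoeff1]
  have h2 : ∀ i j, prolongCoeff2 ξ η i j J = prolongCoeff2 ξ η' i j J := fun i j => by
    rw [prolongCoeff2, totalDeriv1, fderiv_congr_of_eqOn (w := (J.1, J.2.1, J.2.2.1))
      (hU.preimage continuous_fst) (h1 i) hJ, prolongCoeff2, totalDeriv1]
  simp only [prolong2, h2, fun i => h1 i (J.1, J.2.1, J.2.2.1) hJ, h (J.1, J.2.1) ⟨hJ, trivial⟩]

/-- A function on `M` read in a chart agrees with its coordinate formula only over the range of the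
chart. The condition involves only derivatives at points of an open set, so this agreement is
enough. -/
theorem IsLiePointSymmetryOn.congr {H : Jet2 ι → ℝ} {U : Set (ι → ℝ)}
    {ξ : ι → (ι → ℝ) × ℝ → ℝ} {η η' : (ι → ℝ) × ℝ → ℝ} (hL : IsLiePointSymmetryOn H U ξ η)
    (hU : IsOpen U) (h : ∀ w ∈ U ×ˢ (Set.univ : Set ℝ), η' w = η w) :
    IsLiePointSymmetryOn H U ξ η' := by
  obtain ⟨hξ, hη, μ, hμ⟩ := hL
  exact ⟨hξ, hη.congr h, μ, fun J hJ hs => by rw [prolong2_congr hU h H hJ, hμ J hJ hs]⟩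

theorem IsNoetherPointSymmetryOn.congr {n : ℕ} {L : ℝ × (Fin n → ℝ) × (Fin n → ℝ) → ℝ}
    {U : Set (Fin n → ℝ)} {τ : ℝ × (Fin n → ℝ) → ℝ} {η : Fin n → ℝ × (Fin n → ℝ) → ℝ}
    {f f' : ℝ × (Fin n → ℝ) → ℝ} (hN : IsNoetherPointSymmetryOn L U τ η f) (hU : IsOpen U)
    (h : ∀ w ∈ (Set.univ : Set ℝ) ×ˢ U, f' w = f w) : IsNoetherPointSymmetryOn L U τ η f' := by
  obtain ⟨hτ, hη, hf, hN⟩ := hN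
  refine ⟨hτ, hη, hf.congr h, fun t x v hx => ?_⟩
  rw [hN t x v hx, timeDeriv, timeDeriv,
    fderiv_congr_of_eqOn (isOpen_univ.prod hU) h (w := (t, x)) ⟨trivial, hx⟩]

end Congruence

/-! ### From tensors on the manifold to components in a chart -/

section Charts

variable {n : ℕ} {M : Type*} [TopologicalSpace M]
  {e : OpenPartialHomeomorph M (EuclideanSpace ℝ (Fin n))}

theorem contDiff_toLp : ContDiff ℝ ∞ (fun x : Fin n → ℝ => WithLp.toLp 2 x) :=
  (PiLp.continuousLinearEquiv 2 ℝ fun _ : Fin n => ℝ).symm.contDiff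

theorem isOpen_coordRange (e : OpenPartialHomeomorph M (EuclideanSpace ℝ (Fin n))) :
    IsOpen (coordRange e) :=
  e.open_target.preimage contDiff_toLp.continuous

theorem coordPoint_mem_source {x : Fin n → ℝ} (hx : x ∈ coordRange e) :
    coordPoint e x ∈ e.source := e.map_target hx

variable [ChartedSpace (EuclideanSpace ℝ (Fin n)) M]

theorem mdifferentiable_of_mem_maximalAtlas (he : e ∈ IsManifold.maximalAtlas (𝓡 n) ∞ M) :
    e.MDifferentiable (𝓡 n) (𝓡 n) :=
  ⟨(contMDiffOn_of_mem_maximalAtlas he).mdifferentiableOn (by simp),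
    (contMDiffOn_symm_of_mem_maximalAtlas he).mdifferentiableOn (by simp)⟩

theorem mfderiv_coordVec [IsManifold (𝓡 n) ∞ M] (he : e ∈ IsManifold.maximalAtlas (𝓡 n) ∞ M) {x : Fin n → ℝ}
    (hx : x ∈ coordRange e) (i : Fin n) :
    (show EuclideanSpace ℝ (Fin n) from
      mfderiv (𝓡 n) (𝓡 n) e (coordPoint e x) (coordVec e x i)) = EuclideanSpace.single i (1 : ℝ) :=
  congrArg (fun φ => φ (EuclideanSpace.single i (1 : ℝ)))
    ((mdifferentiable_of_mem_maximalAtlas he).comp_symm_deriv hx)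

theorem coordComp_smul (x : Fin n → ℝ) (s : ℝ) (v : TangentSpace (𝓡 n) (coordPoint e x))
    (i : Fin n) : coordComp e x (s • v) i = s * coordComp e x v i := by
  simp only [coordComp, map_smul]
  rfl

theorem eq_sum_coordVec [IsManifold (𝓡 n) ∞ M] (he : e ∈ IsManifold.maximalAtlas (𝓡 n) ∞ M) {x : Fin n → ℝ}
    (hx : x ∈ coordRange e) (v : TangentSpace (𝓡 n) (coordPoint e x)) :
    v = ∑ i, coordComp e x v i • coordVec e x i := by
  apply (mdifferentiable_of_mem_maximalAtlas he).mfderiv_injective (coordPoint_mem_source hx)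
  rw [map_sum]
  simp only [map_smul]
  have h : ∀ w : EuclideanSpace ℝ (Fin n), w = ∑ i, w i • EuclideanSpace.single i (1 : ℝ) :=
    fun w => by
      ext j
      simp [Pi.single_apply]
  refine (h _).trans ?_
  exact Finset.sum_congr rfl fun i _ => congrArg (coordComp e x v i • ·)
    (mfderiv_coordVec he hx i).symm

theorem coordComp_sum_coordVec [IsManifold (𝓡 n) ∞ M] (he : e ∈ IsManifold.maximalAtlas (𝓡 n) ∞ M) {x : Fin n → ℝ}
    (hx : x ∈ coordRange e) (w : Fin n → ℝ) (i : Fin n) :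
    coordComp e x (∑ j, w j • coordVec e x j) i = w i := by
  have h : (show EuclideanSpace ℝ (Fin n) from mfderiv (𝓡 n) (𝓡 n) e (coordPoint e x)
      (∑ j, w j • coordVec e x j)) = ∑ j, w j • EuclideanSpace.single j (1 : ℝ) := by
    refine (map_sum (mfderiv (𝓡 n) (𝓡 n) e (coordPoint e x)) _ _).trans ?_
    refine Finset.sum_congr rfl fun j _ => ?_
    refine (map_smul (mfderiv (𝓡 n) (𝓡 n) e (coordPoint e x)) _ _).trans ?_
    exact congrArg (w j • ·) (mfderiv_coordVec he hx j)
  rw [coordComp, h]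
  simp [Pi.single_apply]

/-- A vector `w` in the kernel of the Gram matrix gives a tangent vector `∑ w_j ∂_j` orthogonal to
every coordinate vector. These span the tangent space, so nondegeneracy makes it zero, and then its
components `w` vanish. -/
theorem Metric.isUnit_det_comp [IsManifold (𝓡 n) ∞ M] (g : Metric n M) (he : e ∈ IsManifold.maximalAtlas (𝓡 n) ∞ M)
    {x : Fin n → ℝ} (hx : x ∈ coordRange e) : IsUnit (g.comp e x).det := by
  rw [isUnit_iff_ne_zero]
  intro h0
  obtain ⟨w, hw, hw0⟩ := Matrix.exists_mulVec_eq_zero_iff.2 h0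
  refine hw (funext fun i => ?_)
  set v : TangentSpace (𝓡 n) (coordPoint e x) := ∑ j, w j • coordVec e x j with hv
  have hvi := coordComp_sum_coordVec he hx w i
  rw [← hv] at hvi
  have hj : ∀ i, g.val (coordPoint e x) (coordVec e x i) v = 0 := fun i => by
    have := congrFun hw0 i
    rw [hv, map_sum]
    simp only [map_smul, smul_eq_mul]
    simp only [Matrix.mulVec, dotProduct, Metric.comp, Matrix.of_apply, Pi.zero_apply] at this
    rw [← this]
    exact Finset.sum_congr rfl fun j _ => mul_comm _ _
  clear_value v
  have hv0 : v = 0 := g.nondegenerate _ v fun u => by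
    rw [g.symm, eq_sum_coordVec he hx u, map_sum, LinearMap.sum_apply]
    refine Finset.sum_eq_zero fun j _ => ?_
    rw [map_smul, LinearMap.smul_apply, hj, smul_zero]
  rw [← hvi, hv0, coordComp, map_zero]
  rfl

theorem contDiffOn_coordPoint {F : M → ℝ} (hF : ContMDiff (𝓡 n) 𝓘(ℝ, ℝ) ∞ F)
    (he : e ∈ IsManifold.maximalAtlas (𝓡 n) ∞ M) :
    ContDiffOn ℝ ∞ (fun x => F (coordPoint e x)) (coordRange e) := by
  have h : ContMDiffOn (𝓡 n) 𝓘(ℝ, ℝ) ∞ (F ∘ e.symm) e.target :=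
    hF.comp_contMDiffOn (contMDiffOn_symm_of_mem_maximalAtlas he)
  exact h.contDiffOn.comp contDiff_toLp.contDiffOn fun x hx => hx

theorem pd_coordPoint [IsManifold (𝓡 n) ∞ M] {F : M → ℝ} (hF : ContMDiff (𝓡 n) 𝓘(ℝ, ℝ) ∞ F)
    (he : e ∈ IsManifold.maximalAtlas (𝓡 n) ∞ M) {x : Fin n → ℝ} (hx : x ∈ coordRange e)
    (i : Fin n) : pd (fun x => F (coordPoint e x)) i x
      = (show ℝ from mfderiv (𝓡 n) 𝓘(ℝ, ℝ) F (coordPoint e x) (coordVec e x i)) := by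
  have h1 : MDifferentiableAt (𝓡 n) 𝓘(ℝ, ℝ) F (coordPoint e x) :=
    hF.mdifferentiable (by simp) _
  have h2 := (mdifferentiable_of_mem_maximalAtlas he).mdifferentiableAt_symm hx
  have h3 := mfderiv_comp (WithLp.toLp 2 x) h1 h2
  have h4 : DifferentiableAt ℝ (F ∘ e.symm) (WithLp.toLp 2 x) :=
    (MDifferentiableAt.comp (WithLp.toLp 2 x) h1 h2).differentiableAt
  have h5 := h4.hasFDerivAt.comp x
    (PiLp.continuousLinearEquiv 2 ℝ fun _ : Fin n => ℝ).symm.hasFDerivAt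
  rw [pd]
  refine (congrArg (fun φ => φ (Pi.single i 1)) h5.fderiv).trans ?_
  rw [mfderiv_eq_fderiv] at h3
  exact congrArg (fun φ => φ (EuclideanSpace.single i (1 : ℝ))) h3

/-- The tangent map of the chart carries `Y` into the tangent bundle of the model space, where the
projection to the fibre is smooth. -/
theorem contDiffOn_coordComp [IsManifold (𝓡 n) ∞ M] {Y : ∀ x : M, TangentSpace (𝓡 n) x}
    (hY : ContMDiff (𝓡 n) (𝓡 n).tangent ∞ (fun x => (⟨x, Y x⟩ : TangentBundle (𝓡 n) M)))
    (he : e ∈ IsManifold.maximalAtlas (𝓡 n) ∞ M) (i : Fin n) :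
    ContDiffOn ℝ ∞ (fun x => coordComp e x (Y (coordPoint e x)) i) (coordRange e) := by
  have h1 := (contMDiffOn_of_mem_maximalAtlas he).contMDiffOn_tangentMapWithin
    (m := ∞) (by simp) e.open_source.uniqueMDiffOn
  have h2 : ContMDiffOn (𝓡 n) (𝓡 n).tangent ∞
      (fun p => tangentMapWithin (𝓡 n) (𝓡 n) e e.source ⟨p, Y p⟩) e.source :=
    h1.comp hY.contMDiffOn fun p hp => hp
  have h3 := (contMDiff_snd_tangentBundle_modelSpace (EuclideanSpace ℝ (Fin n))
    (𝓡 n) (n := ∞)).comp_contMDiffOn h2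
  have h4 := (h3.comp (contMDiffOn_symm_of_mem_maximalAtlas he)
    fun y hy => e.map_target hy).contDiffOn
  have h5 := h4.comp contDiff_toLp.contDiffOn fun (x : Fin n → ℝ) (hx : x ∈ coordRange e) => hx
  have h6 : ContDiffOn ℝ ∞ (fun x => _) (coordRange e) :=
    (EuclideanSpace.proj i : EuclideanSpace ℝ (Fin n) →L[ℝ] ℝ).contDiff.comp_contDiffOn h5
  refine h6.congr fun x hx => ?_
  have h7 := mfderivWithin_of_isOpen (I := 𝓡 n) (I' := 𝓡 n) (f := e) e.open_source
    (coordPoint_mem_source hx)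
  exact congrArg (fun φ => (show EuclideanSpace ℝ (Fin n) from φ (Y (coordPoint e x))) i) h7.symm

theorem HasHomotheticFactor.isHomotheticOn [IsManifold (𝓡 n) ∞ M] {g : Metric n M} {Y : ∀ x : M, TangentSpace (𝓡 n) x}
    {ψ : ℝ} (h : HasHomotheticFactor g Y ψ)
    (hY : ContMDiff (𝓡 n) (𝓡 n).tangent ∞ (fun x => (⟨x, Y x⟩ : TangentBundle (𝓡 n) M)))
    (he : e ∈ IsManifold.maximalAtlas (𝓡 n) ∞ M) :
    IsHomotheticOn (g.comp e) (fun k y => coordComp e y (Y (coordPoint e y)) k) ψ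
      (coordRange e) where
  isOpen := isOpen_coordRange e
  smooth_metric := g.smooth e he
  isSymm x _ := by
    ext i j
    exact g.symm _ _ _
  isUnit_det x hx := g.isUnit_det_comp he hx
  smooth_field := contDiffOn_coordComp hY he
  lieDeriv := h e he

theorem liftedField_coordComp {Y : ∀ x : M, TangentSpace (𝓡 n) x}
    (e : OpenPartialHomeomorph M (EuclideanSpace ℝ (Fin n)))
    (T : ℝ → ℝ) (ξ : ℝ × M × ℝ → ℝ) :
    (fun (a : Option (Fin n)) (w : (Option (Fin n) → ℝ) × ℝ) => a.elim
        (ξ (w.1 none, coordPoint e (fun i => w.1 (some i)), w.2))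
        (coordComp e (fun i => w.1 (some i))
          (T (w.1 none) • Y (coordPoint e (fun i => w.1 (some i))))))
      = liftedField (fun w => ξ (w.1 none, coordPoint e (fun i => w.1 (some i)), w.2)) T
        (fun k y => coordComp e y (Y (coordPoint e y)) k) := by
  funext a w
  cases a with
  | none => rfl
  | some i => exact coordComp_smul _ _ _ _

end Charts

/-- In every chart, the differential of `Y(V) + 2 ψ V` is `c` times the metric dual of `Y`. -/
def HasVariationFactor {n : ℕ} {M : Type*} [TopologicalSpace M]
    [ChartedSpace (EuclideanSpace ℝ (Fin n)) M] (g : Metric n M) (V : M → ℝ)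
    (Y : ∀ x : M, TangentSpace (𝓡 n) x) (ψ c : ℝ) : Prop :=
  ∀ e ∈ IsManifold.maximalAtlas (𝓡 n) ∞ M, ∀ x ∈ coordRange e, ∀ i : Fin n,
    pd (potentialVariation (fun k y => coordComp e y (Y (coordPoint e y)) k) ψ
      fun y => V (coordPoint e y)) i x
      = c * lowered (g.comp e) (fun k y => coordComp e y (Y (coordPoint e y)) k) i x

/-! ### The equivalence on the manifold -/

section Main

variable {n : ℕ} {M : Type*} [TopologicalSpace M] [ChartedSpace (EuclideanSpace ℝ (Fin n)) M]
  [IsManifold (𝓡 n) ∞ M] {g : Metric n M} {V : M → ℝ} {Y : ∀ x : M, TangentSpace (𝓡 n) x}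
  {ψ : ℝ}

/-- The function `Y(V) + 2 ψ V` on `M`. -/
def globalVariation (V : M → ℝ) (Y : ∀ x : M, TangentSpace (𝓡 n) x) (ψ : ℝ) (p : M) : ℝ :=
  (show ℝ from mfderiv (𝓡 n) 𝓘(ℝ, ℝ) V p (Y p)) + 2 * ψ * V p

/-- The symmetry and gauge functions must be defined on all of `M`, not chart by chart. Expanding
`Y` in coordinate vectors shows that the intrinsic function has the required coordinate expression
in every chart. -/
theorem globalVariation_coordPoint (hV : ContMDiff (𝓡 n) 𝓘(ℝ, ℝ) ∞ V)
    {e : OpenPartialHomeomorph M (EuclideanSpace ℝ (Fin n))}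
    (he : e ∈ IsManifold.maximalAtlas (𝓡 n) ∞ M) {x : Fin n → ℝ} (hx : x ∈ coordRange e) :
    globalVariation V Y ψ (coordPoint e x)
      = potentialVariation (fun k y => coordComp e y (Y (coordPoint e y)) k) ψ
        (fun y => V (coordPoint e y)) x := by
  rw [globalVariation, potentialVariation]
  congr 1
  have h := congrArg (mfderiv (𝓡 n) 𝓘(ℝ, ℝ) V (coordPoint e x))
    (eq_sum_coordVec he hx (Y (coordPoint e x)))
  rw [map_sum] at h
  simp only [map_smul] at h
  refine h.trans ?_
  refine Finset.sum_congr rfl fun k _ => ?_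
  rw [pd_coordPoint hV he hx]
  rfl

theorem HasHomotheticFactor.hasVariationFactor_of_lie (h : HasHomotheticFactor g Y ψ)
    (hV : ContMDiff (𝓡 n) 𝓘(ℝ, ℝ) ∞ V)
    (hY : ContMDiff (𝓡 n) (𝓡 n).tangent ∞ (fun x => (⟨x, Y x⟩ : TangentBundle (𝓡 n) M)))
    (hP : ProducesLiePointSymmetry g V Y) : ∃ c, HasVariationFactor g V Y ψ c := by
  obtain ⟨T, hT, ⟨t, ht⟩, ξ, η, hL⟩ := hP
  -- A single time with `T t ≠ 0` serves all points and charts, so `c` is global even when `M` is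
  -- disconnected.
  refine ⟨deriv (deriv T) t / (2 * T t), fun e he x hx i => ?_⟩
  have hLe := hL e he
  rw [liftedField_coordComp] at hLe
  have := (h.isHomotheticOn hY he).lie_compatibility (contDiffOn_coordPoint hV he) hT hLe t hx i
  field_simp
  linarith

theorem HasHomotheticFactor.hasVariationFactor_of_noether (h : HasHomotheticFactor g Y ψ)
    (hV : ContMDiff (𝓡 n) 𝓘(ℝ, ℝ) ∞ V)
    (hY : ContMDiff (𝓡 n) (𝓡 n).tangent ∞ (fun x => (⟨x, Y x⟩ : TangentBundle (𝓡 n) M)))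
    (hP : GeneratesNoetherPointSymmetry g V Y) : ∃ c, HasVariationFactor g V Y ψ c := by
  obtain ⟨T, hT, ⟨t, ht⟩, τ, f, hN⟩ := hP
  refine ⟨-deriv (deriv T) t / T t, fun e he x hx i => ?_⟩
  have hNe := hN e he
  simp only [coordComp_smul] at hNe
  have := (h.isHomotheticOn hY he).noether_compatibility (contDiffOn_coordPoint hV he) hT hNe t
    hx i
  field_simp
  linarith

theorem HasHomotheticFactor.producesLiePointSymmetry (h : HasHomotheticFactor g Y ψ)
    (hV : ContMDiff (𝓡 n) 𝓘(ℝ, ℝ) ∞ V)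
    (hY : ContMDiff (𝓡 n) (𝓡 n).tangent ∞ (fun x => (⟨x, Y x⟩ : TangentBundle (𝓡 n) M)))
    {c : ℝ} (hc : HasVariationFactor g V Y ψ c) : ProducesLiePointSymmetry g V Y := by
  -- This value gives `T'' = 2cT`, as `lie_compatibility` demands.
  obtain ⟨T, α, hT, hα, hT0, hα', hT'⟩ := exists_oscillation (-2 * c)
  refine ⟨T, hT, hT0, fun w => -2 * ψ * α w.1,
    fun w => (α w.1 * globalVariation V Y ψ w.2.1 + -(1 / 2) * n * ψ * T w.1) * w.2.2,
    fun e he => ?_⟩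
  have hL := (h.isHomotheticOn hY he).isLiePointSymmetryOn (contDiffOn_coordPoint hV he)
    (hc e he) hT hα hα' hT'
  have hξ := liftedField_coordComp (Y := Y) e T fun w => -2 * ψ * α w.1
  rw [← hξ] at hL
  refine hL.congr (isOpen_cylinder (isOpen_coordRange e)) fun w hw => ?_
  simp only [globalVariation_coordPoint hV he hw.1]

theorem HasHomotheticFactor.generatesNoetherPointSymmetry (h : HasHomotheticFactor g Y ψ)
    (hV : ContMDiff (𝓡 n) 𝓘(ℝ, ℝ) ∞ V)
    (hY : ContMDiff (𝓡 n) (𝓡 n).tangent ∞ (fun x => (⟨x, Y x⟩ : TangentBundle (𝓡 n) M)))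
    {c : ℝ} (hc : HasVariationFactor g V Y ψ c) : GeneratesNoetherPointSymmetry g V Y := by
  -- Here the outcome is `T'' = -cT`, as `noether_compatibility` demands.
  obtain ⟨T, α, hT, hα, hT0, hα', hT'⟩ := exists_oscillation c
  refine ⟨T, hT, hT0, fun w => -2 * ψ * α w.1, fun w => α w.1 * globalVariation V Y ψ w.2,
    fun e he => ?_⟩
  simp only [coordComp_smul]
  have hN := (h.isHomotheticOn hY he).isNoetherPointSymmetryOn (contDiffOn_coordPoint hV he)
    (hc e he) hT hα hα' hT'
  refine hN.congr (isOpen_coordRange e) fun w hw => ?_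
  simp only [globalVariation_coordPoint hV he hw.2]

end Main

end PointSym

end

theorem proposition3 {n : ℕ} {M : Type*} [TopologicalSpace M]
    [ChartedSpace (EuclideanSpace ℝ (Fin n)) M] [IsManifold (𝓡 n) ∞ M]
    (g : PointSym.Metric n M) (V : M → ℝ) (hV : ContMDiff (𝓡 n) 𝓘(ℝ, ℝ) ∞ V)
    (Y : ∀ x : M, TangentSpace (𝓡 n) x)
    (hY : ContMDiff (𝓡 n) (𝓡 n).tangent ∞ (fun x => (⟨x, Y x⟩ : TangentBundle (𝓡 n) M)))
    (hH : PointSym.IsKilling g Y ∨ PointSym.IsHomothetic g Y) :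
    PointSym.ProducesLiePointSymmetry g V Y ↔ PointSym.GeneratesNoetherPointSymmetry g V Y := by
  obtain ⟨ψ, h⟩ : PointSym.IsHomothetic g Y := hH.elim (fun h => ⟨0, h⟩) id
  constructor
  · intro hP
    obtain ⟨c, hc⟩ := h.hasVariationFactor_of_lie hV hY hP
    exact h.generatesNoetherPointSymmetry hV hY hc
  · intro hP
    obtain ⟨c, hc⟩ := h.hasVariationFactor_of_noether hV hY hP
    exact h.producesLiePointSymmetry hV hY hc
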